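/- Let $P$ be a simple $3$-dimensional convex polytope with $2n$ vertices (simple: every vertex lies in exactly three facets), whose facets are colored with the colors $1,2,3$ so that any two facets sharing an edge have different colors. For a facet $f$ of $P$ let $\xi_f\in\mathbb R^{V(P)}\cong\mathbb R^{2n}$ be its incidence vector, $\xi_f(v)=1$ if the vertex $v$ lies in $f$ and $\xi_f(v)=0$ otherwise. Let $S$ be the set of all $\xi_f$, let $\widetilde P=\operatorname{conv} S$, let $V_i$ be the set of the vectors $\xi_f$ with $f$ of color $i$, and let $m_i$ be the number of facets of color $i$. Suppose $m_3=m_2=m_1\ge 2$. Then $S$ is the set of vertices of $\widetilde P$, and the following hold. (0) Some Gale transform of $\widetilde P$ lies in the plane $\mathbb R^2$, and its normalization to the unit circle (a Gale diagram of $\widetilde P$) takes exactly the vertices in $V_1$, $V_2$, $V_3$ to the points $\left(\tfrac1{\sqrt2},\tfrac1{\sqrt2}\right)$, $(-1,0)$, $(0,-1)$, which thus have multiplicities $m_1$, $m_2$, $m_3$. (A Gale transform of a finite point set $X$ assigns to the points of $X$ the corresponding rows of a matrix whose columns form a basis of the space of affine dependences of $X$.) (1) For $J\subseteq S$, $\operatorname{conv}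 J$ is a proper face of $\widetilde P$ (that is, a face other than $\widetilde P$, the empty face being allowed) if and only if $V_i\not\subseteq J$ for $i=1,2,3$. (2) $\widetilde P$ is simplicial (all its proper faces are simplices) and $(m_2-1)$-neighborly (any $m_2-1$ of its vertices are exactly the vertices of a proper face). (3) There are a point $w$ and a convex $(n-1)$-polytope $Q$ with $\widetilde P=\operatorname{conv}(\{w\}\cup Q)$ such that $Q$ is an $(m_2-1)$-fold $(n-1)$-pyramid whose basis is a polytope combinatorially equivalent to the cyclic polytope $C(2m_2,2m_2-2)$ (of dimension $2m_2-2$, with $2m_2$ vertices), the point $w$ is beyond a facet of $Q$ if and only if that facet is not a simplex, and $Q$ has exactly $m_2-1$ such facets. (An $r$-fold pyramid with basis $K$ arises from $K$ by $r$ times taking the convex hull with a point outside the current affine span; $w$ is beyond a facet $F$ of $Q$ if, within the affine span of $Q$, the hyperplane spanned by $F$ strictly separates $w$ from $Q\setminus F$.) -/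

import Mathlib

namespace PolytopeColoring

section General

variable {W : Type*} [AddCommGroup W] [Module ℝ W]

/-- The dimension of (the affine span of) a nonempty set. -/
noncomputable def dim (A : Set W) : ℕ := Module.finrank ℝ (vectorSpan ℝ A)

/-- A convex `d`-polytope: the convex hull of a nonempty finite set, of dimension `d`. -/
def IsPolytope (d : ℕ) (A : Set W) : Prop :=
  (∃ s : Set W, s.Finite ∧ s.Nonempty ∧ A = convexHull ℝ s) ∧ dim A = d

/-- The vertices of a polytope. -/
abbrev vertices (A : Set W) : Set W := A.extremePoints ℝ

/-- A simplex: the convex hull of finitely many affinely independent points. -/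
def IsSimplex (A : Set W) : Prop :=
  ∃ s : Finset W, AffineIndependent ℝ (fun x : s => (x : W)) ∧ A = convexHull ℝ (s : Set W)

/-- `Q` is a `d`-pyramid with basis `K`. -/
def IsPyramid (d : ℕ) (Q K : Set W) : Prop :=
  ∃ e : ℕ, d = e + 1 ∧ IsPolytope e K ∧
    ∃ a : W, a ∉ affineSpan ℝ K ∧ Q = convexHull ℝ (insert a K)

/-- `Q` is an `r`-fold `d`-pyramid with basis `K`: starting from `K`, the pyramid construction
is applied `r` times, and the result has dimension `d`. -/
def IsFoldPyramid : ℕ → ℕ → Set W → Set W → Prop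
  | 0, d, Q, K => Q = K ∧ IsPolytope d K
  | r + 1, d, Q, K => ∃ L : Set W, IsPyramid d Q L ∧ IsFoldPyramid r (d - 1) L K

/-- `a` is an affine dependence of the points of the finite set `X`: an element of the null space
of the matrix whose columns are the points of `X` with an extra entry `1`. -/
def IsAffineDependence (X : Set W) (a : X → ℝ) : Prop :=
  ∑ᶠ x : X, a x = 0 ∧ ∑ᶠ x : X, a x • (x : W) = 0

/-- `z` is a Gale transform in `ℝ^k` of the finite set `X`: the `k` coordinate functions of `z`
form a basis of the space of affine dependences of `X`. -/
def IsGaleTransform (X : Set W) {k : ℕ} (z : X → EuclideanSpace ℝ (Fin k)) : Prop :=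
  X.Finite ∧ LinearIndependent ℝ (fun (j : Fin k) (x : X) => z x j) ∧
    ∀ a : X → ℝ, IsAffineDependence X a ↔
      a ∈ Submodule.span ℝ (Set.range fun (j : Fin k) (x : X) => z x j)

/-- `g` is a Gale diagram of the finite set `X`: a Gale transform whose nonzero points are
normalized to unit length. -/
def IsGaleDiagram (X : Set W) {k : ℕ} (g : X → EuclideanSpace ℝ (Fin k)) : Prop :=
  ∃ z : X → EuclideanSpace ℝ (Fin k), IsGaleTransform X z ∧ ∀ x, g x = ‖z x‖⁻¹ • z x

variable [TopologicalSpace W]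

/-- A face is the empty set, the polytope itself, or the intersection with a supporting
hyperplane. -/
abbrev IsFace (A F : Set W) : Prop := IsExposed ℝ A F

/-- A proper face is a face (possibly empty) other than the polytope itself. -/
def IsProperFace (A F : Set W) : Prop := IsFace A F ∧ F ≠ A

/-- The facets: the faces of codimension one. -/
def facets (A : Set W) : Set (Set W) := {F | IsFace A F ∧ F.Nonempty ∧ dim F + 1 = dim A}

/-- A polytope is simplicial if all its proper faces are simplices. -/
def IsSimplicial (A : Set W) : Prop := ∀ F, IsProperFace A F → IsSimplex F

/-- A polytope is `k`-neighborly if any `k` of its vertices are exactly the vertices of a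
proper face. -/
def IsNeighborly (k : ℕ) (A : Set W) : Prop :=
  ∀ s : Finset W, (s : Set W) ⊆ vertices A → s.card = k →
    ∃ F, IsProperFace A F ∧ vertices F = s

/-- The point `w` of the affine span of `Q` is beyond the facet `F` of `Q`: the hyperplane
spanned by `F` strictly separates `w` from the rest of `Q`. -/
def IsBeyond (w : W) (Q F : Set W) : Prop :=
  w ∈ affineSpan ℝ Q ∧ ∃ (l : W →L[ℝ] ℝ) (b : ℝ),
    (∀ x ∈ Q, l x ≤ b) ∧ F = {x ∈ Q | l x = b} ∧ b < l w

/-- Two polytopes are combinatorially equivalent if their face lattices are isomorphic. -/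
def CombEquiv {W' : Type*} [AddCommGroup W'] [Module ℝ W'] [TopologicalSpace W']
    (A : Set W) (B : Set W') : Prop :=
  Nonempty ({F : Set W // IsFace A F} ≃o {G : Set W' // IsFace B G})

/-- The convex hull of the points with parameters `t i` on the moment curve in `ℝ^d`. -/
def momentPolytope (d : ℕ) {N : ℕ} (t : Fin N → ℝ) : Set (EuclideanSpace ℝ (Fin d)) :=
  convexHull ℝ (Set.range fun i : Fin N => WithLp.toLp 2 fun j : Fin d => t i ^ ((j : ℕ) + 1))

/-- `K` is of the combinatorial type of the cyclic polytope `C(N, d)`; this type does not depend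
on the choice of the `N` points on the moment curve. -/
def IsCyclicPolytope (N d : ℕ) (K : Set W) : Prop :=
  IsPolytope d K ∧ ∀ t : Fin N → ℝ, StrictMono t → CombEquiv K (momentPolytope d t)

end General

section Incidence

variable {E : Type*} [AddCommGroup E] [Module ℝ E] [TopologicalSpace E]

/-- Every vertex belongs to exactly three facets. -/
def IsSimple3 (P : Set E) : Prop := ∀ v ∈ vertices P, {F ∈ facets P | v ∈ F}.ncard = 3

/-- `c` gives different colors to any two facets that have an edge in common. -/
def IsProperColoring (P : Set E) (c : facets P → Fin 3) : Prop :=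
  ∀ f g : facets P, f ≠ g → dim ((f : Set E) ∩ (g : Set E)) = 1 → c f ≠ c g

/-- The face-vertex incidence vector of `F`, in the space of real functions on the vertices. -/
noncomputable def incidenceVector (P : Set E) (F : Set E) : vertices P → ℝ :=
  fun v => F.indicator 1 (v : E)

/-- The set of incidence vectors of the facets. -/
def incidenceVectors (P : Set E) : Set (vertices P → ℝ) :=
  Set.range fun f : facets P => incidenceVector P f

/-- The convex hull of the incidence vectors of the facets. -/
def incidencePolytope (P : Set E) : Set (vertices P → ℝ) := convexHull ℝ (incidenceVectors P)

/-- The incidence vectors of the facets of color `i`. -/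
def colorClass (P : Set E) (c : facets P → Fin 3) (i : Fin 3) : Set (vertices P → ℝ) :=
  {x | ∃ f : facets P, c f = i ∧ incidenceVector P f = x}

end Incidence

/-- The unit vectors in the directions `(1, 1)`, `(-1, 0)` and `(0, -1)`. -/
noncomputable def galePoint : Fin 3 → EuclideanSpace ℝ (Fin 2) :=
  ![!₂[1 / √2, 1 / √2], !₂[-1, 0], !₂[0, -1]]

end PolytopeColoring

open PolytopeColoring

/-! Every vertex of P lies in exactly one facet of each color, so ∑ a_f ξ_f = 0 says that the three
values of `a` around each vertex add up to 0. An edge lies in two facets, and the third facets at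
its two ends have the same color; the relations at the ends give them the same value. Every vertex
other than the top one for a generic functional has an ascending edge, so `a` is constant on each
color class, with three constants of sum 0 (`sum_smul_incidenceVector_eq_zero_iff`). As the classes
have equal size, all these linear relations are affine.

Hence the polytope is a free sum of three simplices with a common barycenter (`IsFreeSum`), and
everything is read off from this plane of dependences. An index set carries a face iff it is the
zero set of a nonnegative function orthogonal to all dependences (`IsFacial`). Here orthogonality
means that the three class sums agree, so such a set is everything or contains no class
(`IsFreeSum.isFacial_iff`). This gives the vertices, the proper faces, simpliciality and
neighborliness; coordinates on the plane of constants give the Gale diagram.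

For the decomposition, a point w of the first class is deleted. The other points have one dependence
up to a factor (`IsCircuit`): 1 and -1 on the two full classes, 0 on the rest of the class of w,
whose points are therefore apices of a multiple pyramid. The face lattice of the basis depends only
on the numbers of positive and negative coefficients, and points on the moment curve have
alternating signs, hence the same numbers. The dimension n - 1 comes from Euler's formula
(`two_mul_card_facets`), proved by counting facets by their top vertices.

The geometry of P enters through `IsPolytope.exists_frame`: at a simple vertex the edges span the
tangent cone. This rests on the normal cone being generated by facet normals. -/

namespace PolytopeColoring

/-! ### Finite generation of dual cones -/

section DualCone

variable {V : Type*} [AddCommGroup V] [Module ℝ V]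

/-- A functional that is nonnegative on a finite set can be moved in a direction that vanishes
on its zeros and is negative somewhere, until it has a further zero. -/
theorem exists_nonneg_add_smul (G : Finset V) (l l' : Module.Dual ℝ V)
    (hl : ∀ g ∈ G, 0 ≤ l g) (hz : ∀ g ∈ G, l g = 0 → l' g = 0) (hneg : ∃ g ∈ G, l' g < 0) :
    ∃ t : ℝ, 0 < t ∧ (∀ g ∈ G, 0 ≤ (l + t • l') g) ∧
      ∃ g ∈ G, (l + t • l') g = 0 ∧ 0 < l g := by
  classical
  -- Ratio test: the first element of `G` to reach zero as `t` grows minimizes `l g / (-l' g)` among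
  -- those with `l' g < 0`.
  obtain ⟨g₀, hg₀, hmin⟩ := (G.filter fun g => l' g < 0).exists_min_image
    (fun g => l g / (-l' g)) (by obtain ⟨g, hg, h⟩ := hneg; exact ⟨g, by simp [hg, h]⟩)
  rw [Finset.mem_filter] at hg₀
  have hpos : ∀ g ∈ G, l' g < 0 → 0 < l g := fun g hg h =>
    lt_of_le_of_ne (hl g hg) fun h0 => h.ne (hz g hg h0.symm)
  have hl0 := hpos g₀ hg₀.1 hg₀.2
  refine ⟨l g₀ / (-l' g₀), div_pos hl0 (by linarith [hg₀.2]), fun g hg => ?_,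
    g₀, hg₀.1, ?_, hl0⟩
  · simp only [LinearMap.add_apply, LinearMap.smul_apply, smul_eq_mul]
    rcases lt_or_ge (l' g) 0 with h | h
    · have := hmin g (by simp [hg, h])
      rw [le_div_iff₀ (by linarith)] at this
      linarith
    · have : 0 ≤ l g₀ / (-l' g₀) := (div_pos hl0 (by linarith [hg₀.2])).le
      have := hl g hg
      positivity
  · simp only [LinearMap.add_apply, LinearMap.smul_apply, smul_eq_mul]
    have := hg₀.2.ne
    field_simp
    ring

variable [FiniteDimensional ℝ V]

/-- The functionals that are nonnegative on a finite set are generated by those whose zeros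
span a subspace of codimension one. -/
theorem dual_cone_induction (G : Finset V) (p : Module.Dual ℝ V → Prop)
    (hzero : ∀ l : Module.Dual ℝ V, (∀ g ∈ G, l g = 0) → p l)
    (hcomb : ∀ (l₁ l₂ : Module.Dual ℝ V) (a b : ℝ), 0 ≤ a → 0 ≤ b → p l₁ → p l₂ →
      p (a • l₁ + b • l₂))
    (hfacet : ∀ l : Module.Dual ℝ V, (∀ g ∈ G, 0 ≤ l g) →
      Module.finrank ℝ (Submodule.span ℝ {g | g ∈ G ∧ l g = 0}) + 1 =
        Module.finrank ℝ (Submodule.span ℝ (G : Set V)) → p l)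
    (l : Module.Dual ℝ V) (hl : ∀ g ∈ G, 0 ≤ l g) : p l := by
  induction hk : Module.finrank ℝ (Submodule.span ℝ (G : Set V)) -
    Module.finrank ℝ (Submodule.span ℝ {g | g ∈ G ∧ l g = 0}) using Nat.strong_induction_on
    generalizing l with
  | _ k ih =>
  set Z := Submodule.span ℝ {g | g ∈ G ∧ l g = 0} with hZ
  set S := Submodule.span ℝ (G : Set V) with hS
  have hZS : Z ≤ S := Submodule.span_mono fun g hg => hg.1
  have hZl : Z ≤ LinearMap.ker l := Submodule.span_le.2 fun g hg => hg.2
  by_cases h0 : ∀ g ∈ G, l g = 0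
  · exact hzero l h0
  by_cases h1 : Module.finrank ℝ Z + 1 = Module.finrank ℝ S
  · exact hfacet l hl h1
  push Not at h0
  obtain ⟨g₁, hg₁, hlg₁⟩ := h0
  have hlt : Z < S := lt_of_le_of_ne hZS fun h => hlg₁ (hZl (h ▸ Submodule.subset_span hg₁))
  have hfin := Submodule.finrank_lt_finrank_of_lt hlt
  -- A direction that vanishes at this sum, but not on all of `G`, takes both signs on `G`. Asking
  -- for this besides vanishing on `Z` costs at most one dimension, and the codimension of `Z` is at
  -- least two.
  set u := ∑ g ∈ G, g with hu
  -- a direction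
  have hproper : Z ⊔ Submodule.span ℝ {u} < S := by
    refine lt_of_le_of_ne (sup_le hZS ?_) fun h => ?_
    · rw [Submodule.span_singleton_le_iff_mem]
      exact Submodule.sum_mem _ fun g hg => Submodule.subset_span hg
    · have h2 := Submodule.finrank_add_le_finrank_add_finrank Z (Submodule.span ℝ {u})
      have h3 : Module.finrank ℝ (Submodule.span ℝ {u}) ≤ 1 := by
        simpa using finrank_span_le_card ({u} : Set V)
      rw [h] at h2
      omega
  obtain ⟨x, hxS, hx⟩ := SetLike.exists_of_lt hproper
  obtain ⟨l', hl'x, hl'⟩ := Submodule.exists_dual_map_eq_bot_of_notMem hx inferInstance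
  have hl'0 : ∀ y ∈ Z ⊔ Submodule.span ℝ {u}, l' y = 0 := fun y hy => by
    have : l' y ∈ (Z ⊔ Submodule.span ℝ {u}).map l' := Submodule.mem_map_of_mem hy
    rwa [hl', Submodule.mem_bot] at this
  have hl'Z : ∀ g ∈ G, l g = 0 → l' g = 0 := fun g hg h =>
    hl'0 g (Submodule.mem_sup_left (Submodule.subset_span ⟨hg, h⟩))
  have hsum : ∑ g ∈ G, l' g = 0 := by
    rw [← map_sum]
    exact hl'0 _ (Submodule.mem_sup_right (Submodule.mem_span_singleton_self u))
  have hne : ∃ g ∈ G, l' g ≠ 0 := by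
    by_contra! h
    have : S ≤ LinearMap.ker l' := Submodule.span_le.2 fun g hg => h g hg
    exact hl'x (this hxS)
  have hnegex : ∃ g ∈ G, l' g < 0 := by
    by_contra! h
    obtain ⟨g, hg, h'⟩ := hne
    exact h' ((Finset.sum_eq_zero_iff_of_nonneg h).1 hsum g hg)
  have hposex : ∃ g ∈ G, (-l') g < 0 := by
    by_contra! h
    obtain ⟨g, hg, h'⟩ := hne
    refine h' (neg_eq_zero.1 ((Finset.sum_eq_zero_iff_of_nonneg (f := fun g => -l' g) h).1 ?_ g hg))
    simp [hsum]
  have key : ∀ l'' : Module.Dual ℝ V, (∀ g ∈ G, l g = 0 → l'' g = 0) →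
      (∃ g ∈ G, l'' g < 0) → ∃ t : ℝ, 0 < t ∧ p (l + t • l'') := by
    intro l'' hz hneg
    obtain ⟨t, ht, hnn, g, hg, hg0, hgl⟩ := exists_nonneg_add_smul G l l'' hl hz hneg
    refine ⟨t, ht, ih _ ?_ _ hnn rfl⟩
    have hle : Z < Submodule.span ℝ {g | g ∈ G ∧ (l + t • l'') g = 0} := by
      refine lt_of_le_of_ne (Submodule.span_mono fun g hg => ⟨hg.1, ?_⟩) fun h => ?_
      · simp [hg.2, hz g hg.1 hg.2]
      · have : g ∈ Z := h ▸ Submodule.subset_span ⟨hg, hg0⟩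
        exact hgl.ne' (hZl this)
    have := Submodule.finrank_lt_finrank_of_lt hle
    omega
  obtain ⟨t₁, ht₁, hp₁⟩ := key l' hl'Z hnegex
  obtain ⟨t₂, ht₂, hp₂⟩ := key (-l') (fun g hg h => by simp [hl'Z g hg h]) hposex
  -- These weights cancel the multiples of `l'` and leave `l`, which lies on the segment between the
  -- two stopping points.
  have := hcomb _ _ (t₂ / (t₁ + t₂)) (t₁ / (t₁ + t₂)) (by positivity) (by positivity) hp₁ hp₂
  convert this using 1
  ext y
  simp only [LinearMap.add_apply, LinearMap.smul_apply, smul_eq_mul, LinearMap.neg_apply]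
  field_simp
  ring

end DualCone

/-! ### Normal cones and edges at a simple vertex -/

section Polytope

/-- Where `l₀` is positive, a small enough multiple of `l` does no harm; finitely many smallness
conditions hold together. -/
theorem exists_pos_add_mul_nonneg {V : Type*} [AddCommGroup V] [Module ℝ V] (G : Finset V)
    (l₀ l : Module.Dual ℝ V) (h : ∀ g ∈ G, 0 < l₀ g ∨ (l₀ g = 0 ∧ 0 ≤ l g)) :
    ∃ ε : ℝ, 0 < ε ∧ ∀ g ∈ G, 0 ≤ l₀ g + ε * l g := by
  have hev : ∀ᶠ ε in nhdsWithin (0 : ℝ) (Set.Ioi 0), ∀ g ∈ G, 0 ≤ l₀ g + ε * l g := by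
    rw [Filter.eventually_all_finset]
    intro g hg
    rcases h g hg with h | ⟨h, h'⟩
    · have hc : Filter.Tendsto (fun ε : ℝ => l₀ g + ε * l g) (nhds 0) (nhds (l₀ g + 0 * l g)) :=
        (by fun_prop : Continuous fun ε : ℝ => l₀ g + ε * l g).tendsto 0
      rw [zero_mul, add_zero] at hc
      exact ((hc.eventually_const_lt h).mono fun _ h => h.le).filter_mono nhdsWithin_le_nhds
    · filter_upwards [self_mem_nhdsWithin] with ε hε
      rw [h, zero_add]
      exact mul_nonneg (le_of_lt hε) h'
  obtain ⟨ε, hε, hpos⟩ := (hev.and self_mem_nhdsWithin).exists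
  exact ⟨ε, hpos, hε⟩

variable {E : Type*} [NormedAddCommGroup E] [NormedSpace ℝ E]
variable {P : Set E} {d : ℕ} {v : E}

theorem IsPolytope.finite_vertices (hP : IsPolytope d P) : (vertices P).Finite := by
  obtain ⟨⟨s, hs, -, rfl⟩, -⟩ := hP
  exact hs.subset extremePoints_convexHull_subset

theorem IsPolytope.isCompact (hP : IsPolytope d P) : IsCompact P := by
  obtain ⟨⟨s, hs, -, rfl⟩, -⟩ := hP
  exact hs.isCompact_convexHull ℝ

theorem IsPolytope.convex (hP : IsPolytope d P) : Convex ℝ P := by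
  obtain ⟨⟨s, hs, -, rfl⟩, -⟩ := hP
  exact convex_convexHull ℝ s

theorem IsPolytope.nonempty (hP : IsPolytope d P) : P.Nonempty := by
  obtain ⟨⟨s, hs, hne, rfl⟩, -⟩ := hP
  exact hne.convexHull

theorem IsPolytope.convexHull_vertices (hP : IsPolytope d P) : convexHull ℝ (vertices P) = P := by
  conv_rhs => rw [← closure_convexHull_extremePoints hP.isCompact hP.convex]
  exact (hP.finite_vertices.isClosed_convexHull ℝ).closure_eq.symm

theorem vectorSpan_convexHull {W : Type*} [AddCommGroup W] [Module ℝ W] (s : Set W) :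
    vectorSpan ℝ (convexHull ℝ s) = vectorSpan ℝ s := by
  rw [← direction_affineSpan, affineSpan_convexHull, direction_affineSpan]

theorem IsPolytope.vectorSpan_eq_span (hP : IsPolytope d P) (hv : v ∈ vertices P) :
    vectorSpan ℝ P = Submodule.span ℝ ((fun w => w - v) '' vertices P) := by
  conv_lhs => rw [← hP.convexHull_vertices, vectorSpan_convexHull]
  exact vectorSpan_eq_span_vsub_set_right ℝ hv

theorem IsPolytope.forall_nonneg_of_vertices (hP : IsPolytope d P) (l : Module.Dual ℝ E)
    (h : ∀ w ∈ vertices P, 0 ≤ l (w - v)) : ∀ x ∈ P, 0 ≤ l (x - v) := by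
  have : convexHull ℝ (vertices P) ⊆ {x | l v ≤ l x} :=
    convexHull_min (fun w hw => by simpa using h w hw)
      (convex_halfSpace_ge l.isLinear (l v))
  rw [hP.convexHull_vertices] at this
  intro x hx
  simpa using this hx

/-- A functional that is positive on all edges at a vertex. -/
theorem IsPolytope.exists_pos_at_vertex (hP : IsPolytope d P) (hv : v ∈ vertices P) :
    ∃ l : Module.Dual ℝ E, ∀ w ∈ vertices P, w ≠ v → 0 < l (w - v) := by
  have h1 := (hP.convex.mem_extremePoints_iff_mem_sdiff_convexHull_sdiff.1 hv).2
  have h2 : v ∉ convexHull ℝ (vertices P \ {v}) := fun h =>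
    h1 (convexHull_mono (Set.sdiff_subset_sdiff_left extremePoints_subset) h)
  obtain ⟨f, u, hu, hf⟩ := geometric_hahn_banach_point_closed (convex_convexHull ℝ _)
    ((hP.finite_vertices.subset Set.sdiff_subset).isClosed_convexHull ℝ) h2
  refine ⟨f, fun w hw hwv => ?_⟩
  have := hf w (subset_convexHull ℝ _ ⟨hw, hwv⟩)
  simp only [ContinuousLinearMap.coe_coe, map_sub]
  linarith

theorem eq_on_vectorSpan {W : Type*} [AddCommGroup W] [Module ℝ W] {A : Set W} {v : W}
    (hv : v ∈ A) {l l' : Module.Dual ℝ W} (h : ∀ x ∈ A, l (x - v) = l' (x - v)) :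
    ∀ y ∈ vectorSpan ℝ A, l y = l' y := by
  have : vectorSpan ℝ A ≤ LinearMap.ker (l - l') := by
    rw [vectorSpan_eq_span_vsub_set_right ℝ hv, Submodule.span_le]
    rintro _ ⟨x, hx, rfl⟩
    simp only [vsub_eq_sub, SetLike.mem_coe, LinearMap.mem_ker, LinearMap.sub_apply]
    rw [h x hx, sub_self]
  intro y hy
  simpa [sub_eq_zero] using this hy

theorem exists_functional_of_isExposed {F : Set E} (hF : IsExposed ℝ P F) (hv : v ∈ F) :
    ∃ l : Module.Dual ℝ E, (∀ x ∈ P, 0 ≤ l (x - v)) ∧ ∀ x ∈ P, x ∈ F ↔ l (x - v) = 0 := by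
  obtain ⟨l, rfl⟩ := hF ⟨v, hv⟩
  refine ⟨-(l : E →ₗ[ℝ] ℝ), fun x hx => ?_, fun x hx => ?_⟩
  · have := hv.2 x hx
    simp only [LinearMap.neg_apply, ContinuousLinearMap.coe_coe, map_sub]
    linarith
  · simp only [LinearMap.neg_apply, ContinuousLinearMap.coe_coe, map_sub, Set.mem_ofPred_eq]
    refine ⟨fun h => ?_, fun h => ⟨hx, fun y hy => ?_⟩⟩
    · linarith [h.2 v hv.1, hv.2 x hx]
    · linarith [hv.2 y hy]

variable [FiniteDimensional ℝ E]

theorem isExposed_zeros (hv : v ∈ P) (l : Module.Dual ℝ E) (hl : ∀ x ∈ P, 0 ≤ l (x - v)) :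
    IsExposed ℝ P {x | x ∈ P ∧ l (x - v) = 0} := by
  intro _
  refine ⟨-l.toContinuousLinearMap, ?_⟩
  ext x
  simp only [Set.mem_ofPred_eq, neg_apply,
    LinearMap.coe_toContinuousLinearMap', neg_le_neg_iff]
  refine and_congr_right fun hx => ⟨fun h y hy => ?_, fun h => ?_⟩
  · have := hl y hy
    rw [map_sub] at this h
    linarith
  · have := hl x hx
    have := h v hv
    rw [map_sub] at *
    linarith

/-- The normal cone of a polytope at a vertex is generated by the facet normals. -/
theorem IsPolytope.normal_induction (hP : IsPolytope d P) (hv : v ∈ vertices P)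
    (p : Module.Dual ℝ E → Prop)
    (hzero : ∀ l : Module.Dual ℝ E, (∀ x ∈ P, l (x - v) = 0) → p l)
    (hcomb : ∀ (l₁ l₂ : Module.Dual ℝ E) (a b : ℝ), 0 ≤ a → 0 ≤ b → p l₁ → p l₂ →
      p (a • l₁ + b • l₂))
    (hfacet : ∀ l : Module.Dual ℝ E, (∀ x ∈ P, 0 ≤ l (x - v)) →
      {x | x ∈ P ∧ l (x - v) = 0} ∈ facets P → p l)
    (l : Module.Dual ℝ E) (hl : ∀ x ∈ P, 0 ≤ l (x - v)) : p l := by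
  classical
  have hvP : v ∈ P := hv.1
  set G : Finset E := hP.finite_vertices.toFinset.image fun w => w - v with hG
  have hGc : (G : Set E) = (fun w => w - v) '' vertices P := by
    rw [hG, Finset.coe_image, Set.Finite.coe_toFinset]
  have hspan := hP.vectorSpan_eq_span hv
  rw [← hGc] at hspan
  have hmem : ∀ g ∈ G, ∃ w ∈ vertices P, w - v = g := fun g hg => by
    have : g ∈ (G : Set E) := hg
    rwa [hGc] at this
  have hmem' : ∀ w ∈ vertices P, w - v ∈ G := fun w hw => by
    rw [← Finset.mem_coe, hGc]
    exact ⟨w, hw, rfl⟩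
  refine dual_cone_induction G p (fun l h => hzero l fun x hx => ?_) hcomb (fun l h hd => ?_) l
    fun g hg => ?_
  · have hle : vectorSpan ℝ P ≤ LinearMap.ker l := by
      rw [hspan]
      exact Submodule.span_le.2 fun g hg => h g hg
    exact hle (vsub_mem_vectorSpan ℝ hx hvP)
  · have hnn : ∀ x ∈ P, 0 ≤ l (x - v) :=
      hP.forall_nonneg_of_vertices l fun w hw => h _ (hmem' w hw)
    have hvF : v ∈ {x | x ∈ P ∧ l (x - v) = 0} := ⟨hvP, by simp⟩
    refine hfacet l hnn ⟨isExposed_zeros hvP l hnn, ⟨v, hvF⟩, ?_⟩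
    set F := {x | x ∈ P ∧ l (x - v) = 0} with hF
    rw [← hspan] at hd
    -- The direction space of `F` lies between the span of the zeros of `l` in `G`, which has
    -- codimension one, and that of `P`; the second inclusion is strict, so `F` is a facet.
    have h1 : Submodule.span ℝ {g | g ∈ G ∧ l g = 0} ≤ vectorSpan ℝ F := by
      rw [Submodule.span_le]
      rintro g ⟨hg, hlg⟩
      obtain ⟨w, hw, rfl⟩ := hmem g hg
      exact vsub_mem_vectorSpan ℝ ⟨hw.1, hlg⟩ hvF
    have h2 : vectorSpan ℝ F < vectorSpan ℝ P := by
      refine lt_of_le_of_ne (vectorSpan_mono ℝ fun x hx => hx.1) fun heq => ?_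
      have h3 : ∀ y ∈ vectorSpan ℝ F, l y = (0 : Module.Dual ℝ E) y :=
        eq_on_vectorSpan hvF fun x hx => hx.2
      have h4 : {g | g ∈ G ∧ l g = 0} = (G : Set E) := by
        ext g
        refine ⟨fun h => h.1, fun hg => ⟨hg, ?_⟩⟩
        have : g ∈ vectorSpan ℝ F := by
          rw [heq, hspan]
          exact Submodule.subset_span hg
        exact h3 g this
      rw [h4, ← hspan] at hd
      omega
    have h5 := Submodule.finrank_mono h1
    have h6 := Submodule.finrank_lt_finrank_of_lt h2
    unfold dim
    omega
  · obtain ⟨w, hw, rfl⟩ := hmem g hg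
    exact hl w hw.1

/-- A facet normal is unique up to a factor. -/
theorem facet_normal_unique {F : Set E} (hF : F ∈ facets P) (hv : v ∈ F)
    {l β : Module.Dual ℝ E} (hl : ∀ x ∈ P, 0 ≤ l (x - v)) (hβ : ∀ x ∈ P, 0 ≤ β (x - v))
    (hlF : ∀ x ∈ F, l (x - v) = 0) (hβF : ∀ x ∈ P, x ∈ F ↔ β (x - v) = 0) :
    ∃ c : ℝ, 0 ≤ c ∧ ∀ x ∈ P, l (x - v) = c * β (x - v) := by
  have hFP : F ⊆ P := hF.1.subset
  have hvP := hFP hv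
  obtain ⟨x₀, hx₀, hx₀F⟩ : ∃ x ∈ P, x ∉ F := by
    by_contra! h
    have : F = P := hFP.antisymm h
    have h3 := hF.2.2
    rw [this] at h3
    omega
  have hb : 0 < β (x₀ - v) := lt_of_le_of_ne (hβ _ hx₀) fun h => hx₀F ((hβF _ hx₀).2 h.symm)
  -- With this factor `l - c • β` vanishes on `F` and at `x₀` outside `F`, hence on all of `P`,
  -- since `F` has codimension one.
  set c := l (x₀ - v) / β (x₀ - v) with hc
  refine ⟨c, div_nonneg (hl _ hx₀) hb.le, ?_⟩
  have hx₀V : x₀ - v ∈ vectorSpan ℝ P := vsub_mem_vectorSpan ℝ hx₀ hvP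
  have h1 : vectorSpan ℝ F < LinearMap.ker (l - c • β) ⊓ vectorSpan ℝ P := by
    refine lt_of_le_of_ne (le_inf (fun y hy => ?_) (vectorSpan_mono ℝ hFP)) fun h => ?_
    · have e1 := eq_on_vectorSpan (l' := 0) hv (fun x hx => hlF x hx) y hy
      have e2 := eq_on_vectorSpan (l' := 0) hv (fun x hx => (hβF x (hFP hx)).1 hx) y hy
      simp [e1, e2]
    · have : x₀ - v ∈ vectorSpan ℝ F := by
        rw [h]
        refine ⟨?_, hx₀V⟩
        have := hb.ne'
        simp only [SetLike.mem_coe, LinearMap.mem_ker, LinearMap.sub_apply, LinearMap.smul_apply,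
          smul_eq_mul, hc]
        field_simp
        ring
      have e2 := eq_on_vectorSpan (l' := 0) hv (fun x hx => (hβF x (hFP hx)).1 hx) _ this
      exact hb.ne' e2
  have h2 := Submodule.finrank_lt_finrank_of_lt h1
  have h3 : Module.finrank ℝ (vectorSpan ℝ F) + 1 = Module.finrank ℝ (vectorSpan ℝ P) := hF.2.2
  have h4 : LinearMap.ker (l - c • β) ⊓ vectorSpan ℝ P = vectorSpan ℝ P :=
    Submodule.eq_of_le_of_finrank_le inf_le_right (by omega)
  intro x hx
  have : x - v ∈ LinearMap.ker (l - c • β) ⊓ vectorSpan ℝ P := by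
    rw [h4]
    exact vsub_mem_vectorSpan ℝ hx hvP
  simpa [sub_eq_zero] using this.1

/-- At a vertex `v` that lies in exactly `d` facets, there are neighbors `w k`, one on every
edge, such that the tangent cone is spanned by the directions `w k - v`. -/
theorem IsPolytope.exists_frame (hP : IsPolytope d P) (hv : v ∈ vertices P) (hd : d ≠ 0)
    (hcard : {F ∈ facets P | v ∈ F}.ncard = d) :
    ∃ (F : Fin d → Set E) (w : Fin d → E), Function.Injective F ∧
      Set.range F = {F ∈ facets P | v ∈ F} ∧ (∀ k, w k ∈ vertices P) ∧
      (∀ k i, w k ∈ F i ↔ i ≠ k) ∧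
      ∀ x ∈ P, ∃ t : Fin d → ℝ, (∀ k, 0 ≤ t k) ∧ x - v = ∑ k, t k • (w k - v) ∧
        ∀ k, x ∈ F k ↔ t k = 0 := by
  classical
  have hvP : v ∈ P := hv.1
  have : Finite {F ∈ facets P | v ∈ F} := Set.finite_of_ncard_ne_zero (by omega)
  let e : {F ∈ facets P | v ∈ F} ≃ Fin d := Finite.equivFinOfCardEq hcard
  set F : Fin d → Set E := fun i => (e.symm i : Set E) with hFdef
  have hF : ∀ i, F i ∈ facets P ∧ v ∈ F i := fun i => (e.symm i).2
  have hFex : ∀ G ∈ facets P, v ∈ G → ∃ i, F i = G := fun G hG hvG =>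
    ⟨e ⟨G, hG, hvG⟩, by simp [F]⟩
  choose β hβ hβF using fun i => exists_functional_of_isExposed (hF i).1.1 (hF i).2
  -- The `d` facet normals at `v` generate the normal cone.
  have normal : ∀ l : Module.Dual ℝ E, (∀ x ∈ P, 0 ≤ l (x - v)) →
      ∃ c : Fin d → ℝ, (∀ i, 0 ≤ c i) ∧ ∀ x ∈ P, l (x - v) = ∑ i, c i * β i (x - v) := by
    refine hP.normal_induction hv _ (fun l hl => ⟨0, by simp, fun x hx => by simp [hl x hx]⟩)
      ?_ ?_
    · rintro l₁ l₂ a b ha hb ⟨c₁, hc₁, h₁⟩ ⟨c₂, hc₂, h₂⟩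
      refine ⟨fun i => a * c₁ i + b * c₂ i, fun i => ?_, fun x hx => ?_⟩
      · have := hc₁ i
        have := hc₂ i
        positivity
      · simp only [LinearMap.add_apply, LinearMap.smul_apply, smul_eq_mul, h₁ x hx, h₂ x hx,
          Finset.mul_sum, ← Finset.sum_add_distrib]
        exact Finset.sum_congr rfl fun i _ => by ring
    · intro l hl hlF
      obtain ⟨i, hi⟩ := hFex _ hlF ⟨hvP, by simp⟩
      obtain ⟨c, hc, h⟩ := facet_normal_unique (hF i).1 (hF i).2 hl (hβ i)
        (fun x hx => by rw [hi] at hx; exact hx.2) (hβF i)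
      refine ⟨Pi.single i c, fun j => ?_, fun x hx => ?_⟩
      · by_cases hj : j = i
        · subst hj; simpa
        · simp [hj]
      · rw [h x hx, Finset.sum_eq_single i]
        · simp
        · intro j _ hj; simp [hj]
        · simp
  have normal' : ∀ l : Module.Dual ℝ E, (∀ x ∈ P, 0 ≤ l (x - v)) →
      ∃ c : Fin d → ℝ, (∀ i, 0 ≤ c i) ∧ ∀ y ∈ vectorSpan ℝ P, l y = ∑ i, c i * β i y := by
    intro l hl
    obtain ⟨c, hc, h⟩ := normal l hl
    refine ⟨c, hc, fun y hy => ?_⟩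
    have := eq_on_vectorSpan (l := l) (l' := ∑ i, c i • β i) hvP
      (fun x hx => by simpa using h x hx) y hy
    simpa using this
  set G : Finset E := hP.finite_vertices.toFinset.image fun w => w - v with hG
  have hmem : ∀ g ∈ G, ∃ w ∈ vertices P, w - v = g := fun g hg => by
    simpa [hG] using hg
  have hmem' : ∀ w ∈ vertices P, w - v ∈ G := fun w hw =>
    Finset.mem_image_of_mem _ (by simpa using hw)
  -- The normal cone is full-dimensional: for `l₀` positive on all vertices but `v`, both `l₀` and
  -- `l₀ + ε • l` are normal for any `l` and small `ε`. A `y` killed by all `β i` is killed by both,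
  -- hence by every `l`.
  have hinj : ∀ y ∈ vectorSpan ℝ P, (∀ i, β i y = 0) → y = 0 := by
    intro y hy h
    obtain ⟨l₀, hl₀⟩ := hP.exists_pos_at_vertex hv
    have hN : ∀ l : Module.Dual ℝ E, (∀ x ∈ P, 0 ≤ l (x - v)) → l y = 0 := by
      intro l hl
      obtain ⟨c, -, hc⟩ := normal' l hl
      simp [hc y hy, h]
    have hl₀P : ∀ x ∈ P, 0 ≤ l₀ (x - v) := hP.forall_nonneg_of_vertices l₀ fun w hw => by
      by_cases hwv : w = v
      · simp [hwv]
      · exact (hl₀ w hw hwv).le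
    rw [← Module.forall_dual_apply_eq_zero_iff ℝ]
    intro l
    obtain ⟨ε, hε, h'⟩ := exists_pos_add_mul_nonneg G l₀ l fun g hg => by
      obtain ⟨w, hw, rfl⟩ := hmem g hg
      by_cases hwv : w = v
      · simp [hwv]
      · exact Or.inl (hl₀ w hw hwv)
    have h1 := hN (l₀ + ε • l) (hP.forall_nonneg_of_vertices _ fun w hw => by
      simpa using h' _ (hmem' w hw))
    have h2 := hN l₀ hl₀P
    simpa [h2, hε.ne'] using h1
  -- The `d` normals are injective coordinates on a space of dimension `d`, so they have a dual
  -- basis.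
  have hbasis : ∀ k, ∃ y ∈ vectorSpan ℝ P, ∀ i, β i y = if i = k then 1 else 0 := by
    let L : vectorSpan ℝ P →ₗ[ℝ] (Fin d → ℝ) :=
      LinearMap.pi fun i => (β i).comp (vectorSpan ℝ P).subtype
    have hLinj : Function.Injective L := by
      rw [← LinearMap.ker_eq_bot, LinearMap.ker_eq_bot']
      intro y hy
      exact Subtype.ext (hinj y y.2 fun i => congrFun hy i)
    have hLsurj : Function.Surjective L :=
      (LinearMap.injective_iff_surjective_of_finrank_eq_finrank (by
        rw [Module.finrank_fin_fun]; exact hP.2)).1 hLinj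
    intro k
    obtain ⟨y, hy⟩ := hLsurj fun i => if i = k then 1 else 0
    exact ⟨y, y.2, fun i => congrFun hy i⟩
  -- If every vertex but `v` were off the `k`-th edge, the sum of the other normals would be
  -- positive there, and a small multiple of `β k` could be subtracted. The result is a nonnegative
  -- combination of the normals, but its value at the `k`-th dual vector is `-ε`.
  have hw : ∀ k, ∃ w ∈ vertices P, w ≠ v ∧ ∀ i, i ≠ k → β i (w - v) = 0 := by
    intro k
    by_contra! hcon
    obtain ⟨ε, hε, h'⟩ := exists_pos_add_mul_nonneg G (∑ i ∈ Finset.univ.erase k, β i) (-β k)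
      fun g hg => by
        obtain ⟨w, hw, rfl⟩ := hmem g hg
        by_cases hwv : w = v
        · simp [hwv]
        · left
          obtain ⟨i, hik, hi⟩ := hcon w hw hwv
          rw [LinearMap.sum_apply]
          exact Finset.sum_pos' (fun j _ => hβ j w hw.1)
            ⟨i, by simp [hik], lt_of_le_of_ne (hβ i w hw.1) (Ne.symm hi)⟩
    obtain ⟨c, hc, h⟩ := normal' (∑ i ∈ Finset.univ.erase k, β i + ε • (-β k))
      (hP.forall_nonneg_of_vertices _ fun w hw => by
        have := h' _ (hmem' w hw)
        simp only [LinearMap.add_apply, LinearMap.smul_apply, smul_eq_mul]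
        exact this)
    obtain ⟨y, hy, hyβ⟩ := hbasis k
    have h1 := h y hy
    simp only [LinearMap.add_apply, LinearMap.sum_apply, LinearMap.smul_apply, smul_eq_mul,
      LinearMap.neg_apply, hyβ] at h1
    rw [Finset.sum_eq_zero (fun i hi => by simp [Finset.ne_of_mem_erase hi])] at h1
    simp at h1
    linarith [hc k]
  choose w hwv hwne hwβ using hw
  have hwβpos : ∀ k, 0 < β k (w k - v) := by
    intro k
    refine lt_of_le_of_ne (hβ k _ (hwv k).1) fun h => hwne k (sub_eq_zero.1 ?_)
    refine hinj _ (vsub_mem_vectorSpan ℝ (hwv k).1 hvP) fun i => ?_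
    by_cases hik : i = k
    · rw [hik, ← h]
    · exact hwβ k i hik
  refine ⟨F, w, fun i j hij => e.symm.injective (Subtype.ext hij), ?_, hwv, fun k i => ?_,
    fun x hx => ?_⟩
  · ext G
    constructor
    · rintro ⟨i, rfl⟩
      exact hF i
    · rintro ⟨hG, hvG⟩
      exact hFex G hG hvG
  · rw [hβF i _ (hwv k).1]
    refine ⟨fun h hik => ?_, hwβ k i⟩
    subst hik
    exact (hwβpos i).ne' h
  · refine ⟨fun k => β k (x - v) / β k (w k - v), fun k => div_nonneg (hβ k x hx) (hwβpos k).le,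
      ?_, fun k => ?_⟩
    · rw [← sub_eq_zero]
      refine hinj _ (Submodule.sub_mem _ (vsub_mem_vectorSpan ℝ hx hvP)
        (Submodule.sum_mem _ fun k _ => Submodule.smul_mem _ _
          (vsub_mem_vectorSpan ℝ (hwv k).1 hvP))) fun i => ?_
      rw [map_sub, map_sum, Finset.sum_eq_single i]
      · have := (hwβpos i).ne'
        rw [map_smul, smul_eq_mul]
        field_simp
        ring
      · intro k _ hk
        rw [map_smul, hwβ k i (Ne.symm hk), smul_zero]
      · simp
    · rw [hβF k x hx, div_eq_zero_iff]
      exact ⟨Or.inl, fun h => h.resolve_right (hwβpos k).ne'⟩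

end Polytope

/-! ### Colored vertex frames and the dependences of incidence vectors -/

section Coloring

variable {E : Type*} [NormedAddCommGroup E] [NormedSpace ℝ E]

/-- The facets at a vertex `v` of a simple 3-polytope, indexed by their colors; `w k` is a
vertex on the edge at `v` that is not in the facet of color `k`. -/
structure VertexFrame (P : Set E) (c : facets P → Fin 3) (v : E) where
  F : Fin 3 → facets P
  w : Fin 3 → E
  color : ∀ k, c (F k) = k
  mem : ∀ k, v ∈ (F k : Set E)
  eq_of_mem : ∀ f : facets P, v ∈ (f : Set E) → F (c f) = f
  w_mem : ∀ k, w k ∈ vertices P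
  w_mem_iff : ∀ k i, w k ∈ (F i : Set E) ↔ i ≠ k
  coord : ∀ x ∈ P, ∃ t : Fin 3 → ℝ, (∀ k, 0 ≤ t k) ∧ x - v = ∑ k, t k • (w k - v) ∧
    ∀ k, x ∈ (F k : Set E) ↔ t k = 0

/-- The points of `X` where `h` is maximal form an exposed subset, and extreme points of an exposed
subset of an exposed subset are extreme in `P`. -/
theorem IsPolytope.exists_isMax_vertex {P X : Set E} {d : ℕ} (hP : IsPolytope d P)
    (hX : IsExposed ℝ P X) (hne : X.Nonempty) (h : E →L[ℝ] ℝ) :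
    ∃ v ∈ vertices P, v ∈ X ∧ ∀ x ∈ X, h x ≤ h v := by
  have hXc : IsCompact X := hX.isCompact hP.isCompact
  have hY : IsExposed ℝ X (h.toExposed X) := ContinuousLinearMap.toExposed.isExposed
  obtain ⟨x, hx, hmax⟩ := hXc.exists_isMaxOn hne h.continuous.continuousOn
  obtain ⟨v, hv⟩ := (hY.isCompact hXc).extremePoints_nonempty ⟨x, hx, fun y hy => hmax hy⟩
  exact ⟨v, (hX.isExtreme.trans hY.isExtreme).extremePoints_subset_extremePoints hv,
    hv.1.1, hv.1.2⟩

variable {P : Set E} {c : facets P → Fin 3} {v : E}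

/-- Points common to two of the three facets at `v` have only one nonzero edge coordinate, so these
facets share an edge and differ in color. Thus the colors index the facets at `v`. -/
theorem nonempty_vertexFrame [FiniteDimensional ℝ E] (hP : IsPolytope 3 P) (hsimple : IsSimple3 P)
    (hc : IsProperColoring P c) (hv : v ∈ vertices P) : Nonempty (VertexFrame P c v) := by
  obtain ⟨F, w, hFinj, hFrange, hw, hwF, hcoord⟩ :=
    hP.exists_frame hv three_ne_zero (hsimple v hv)
  have hF : ∀ i, F i ∈ facets P ∧ v ∈ F i := fun i => by
    have : F i ∈ {F ∈ facets P | v ∈ F} := hFrange ▸ Set.mem_range_self i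
    exact this
  let F' : Fin 3 → facets P := fun i => ⟨F i, (hF i).1⟩
  have hinj : Function.Injective fun i => c (F' i) := by
    intro i j hij
    by_contra hne
    obtain ⟨k, hki, hkj, hk⟩ : ∃ k, k ≠ i ∧ k ≠ j ∧ ∀ l, l ≠ k → l = i ∨ l = j := by
      clear hij
      revert i j; decide
    refine hc (F' i) (F' j) (fun h => hne (hFinj (congrArg Subtype.val h))) ?_ hij
    have hvFF : v ∈ F i ∩ F j := ⟨(hF i).2, (hF j).2⟩
    have hspan : vectorSpan ℝ (F i ∩ F j) = Submodule.span ℝ {w k - v} := by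
      rw [vectorSpan_eq_span_vsub_set_right ℝ hvFF]
      apply le_antisymm
      · rw [Submodule.span_le]
        rintro _ ⟨x, hx, rfl⟩
        obtain ⟨t, -, ht, htF⟩ := hcoord x ((hF i).1.1.subset hx.1)
        rw [Finset.sum_eq_single k] at ht
        · simp only [vsub_eq_sub, SetLike.mem_coe, ht]
          exact Submodule.smul_mem _ _ (Submodule.mem_span_singleton_self _)
        · intro l _ hl
          have : t l = 0 := by
            rw [← htF l]
            rcases hk l hl with rfl | rfl
            exacts [hx.1, hx.2]
          rw [this, zero_smul]
        · simp
      · rw [Submodule.span_singleton_le_iff_mem]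
        exact Submodule.subset_span
          ⟨w k, ⟨(hwF k i).2 hki.symm, (hwF k j).2 hkj.symm⟩, rfl⟩
    change Module.finrank ℝ (vectorSpan ℝ (F i ∩ F j)) = 1
    rw [hspan]
    refine finrank_span_singleton (sub_ne_zero.2 fun h => ?_)
    exact (hwF k k).1 (h ▸ (hF k).2) rfl
  let τ : Fin 3 ≃ Fin 3 := Equiv.ofBijective _ hinj.bijective_of_finite
  have hτ : ∀ k, c (F' (τ.symm k)) = k := fun k => τ.apply_symm_apply k
  refine ⟨⟨fun k => F' (τ.symm k), fun k => w (τ.symm k), hτ, fun k => (hF _).2, fun f hf => ?_,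
    fun k => hw _, fun k i => ?_, fun x hx => ?_⟩⟩
  · have : (f : Set E) ∈ Set.range F := hFrange ▸ ⟨f.2, hf⟩
    obtain ⟨i, hi⟩ := this
    have hfi : f = F' i := Subtype.ext hi.symm
    have : τ i = c f := by rw [hfi]; rfl
    rw [← this, Equiv.symm_apply_apply, hfi]
  · exact (hwF _ _).trans (by simp)
  · obtain ⟨t, ht0, ht, htF⟩ := hcoord x hx
    refine ⟨fun k => t (τ.symm k), fun k => ht0 _, ?_, fun k => htF _⟩
    rw [ht]
    exact (Equiv.sum_comp τ.symm fun k => t k • (w k - v)).symm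

theorem VertexFrame.w_ne (Φ : VertexFrame P c v) (k : Fin 3) : Φ.w k ≠ v := fun h =>
  (Φ.w_mem_iff k k).1 (by rw [h]; exact Φ.mem k) rfl

/-- The simplex method's local criterion: in the tangent cone at `v` only the edges in `s`
contribute, and `h` does not rise along them. -/
theorem VertexFrame.le_of_mem (Φ : VertexFrame P c v) (h : E →L[ℝ] ℝ) {s : Set (Fin 3)}
    (hs : ∀ i ∈ s, h (Φ.w i) ≤ h v) {x : E} (hx : x ∈ P) (hxs : ∀ i ∉ s, x ∈ (Φ.F i : Set E)) :
    h x ≤ h v := by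
  obtain ⟨t, ht0, ht, htF⟩ := Φ.coord x hx
  have : h (x - v) = ∑ k, t k * (h (Φ.w k) - h v) := by rw [ht]; simp
  rw [map_sub] at this
  have hle : ∑ k, t k * (h (Φ.w k) - h v) ≤ 0 := Finset.sum_nonpos fun k _ => by
    by_cases hk : k ∈ s
    · exact mul_nonpos_of_nonneg_of_nonpos (ht0 k) (by linarith [hs k hk])
    · rw [(htF k).1 (hxs k hk), zero_mul]
  linarith

theorem exists_injOn_functional [FiniteDimensional ℝ E] {V : Set E} (hV : V.Finite) :
    ∃ h : E →L[ℝ] ℝ, Set.InjOn h V := by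
  have := hV.to_subtype
  obtain ⟨f, hf⟩ := Module.exists_dual_forall_apply_ne_zero (K := ℝ)
    (fun p : {p : V × V // p.1 ≠ p.2} => (p.1.1 : E) - p.1.2)
    fun p h => p.2 (Subtype.ext (sub_eq_zero.1 h))
  refine ⟨f.toContinuousLinearMap, fun x hx y hy hxy => ?_⟩
  by_contra hne
  refine hf ⟨(⟨x, hx⟩, ⟨y, hy⟩), fun h => hne (congrArg Subtype.val h)⟩ ?_
  simpa [sub_eq_zero] using hxy

/-! ### Euler's formula by sweeping with a generic functional -/

section Euler

open Classical in
-- Each facet has a unique top vertex. The facet of color `k` at `v` contains the two edges with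
-- index other than `k`, and `v` is its top iff both descend.
theorem card_facets_eq_sum (hP : IsPolytope 3 P) [Fintype (vertices P)] [Fintype (facets P)]
    (Φ : ∀ v : vertices P, VertexFrame P c v) (h : E →L[ℝ] ℝ) (hinj : Set.InjOn h (vertices P)) :
    Fintype.card (facets P) =
      ∑ v : vertices P, (Finset.univ.filter fun k => ∀ i, i ≠ k → h ((Φ v).w i) < h v).card := by
  have hlocal : ∀ (v : vertices P) k, (∀ i, i ≠ k → h ((Φ v).w i) < h v) ↔
      ∀ x ∈ ((Φ v).F k : Set E), h x ≤ h v := by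
    intro v k
    constructor
    · intro H x hx
      refine (Φ v).le_of_mem h (s := {i | i ≠ k}) (fun i hi => (H i hi).le)
        (((Φ v).F k).2.1.subset hx) fun i hi => ?_
      simp only [ne_eq, Set.mem_ofPred_eq, not_not] at hi
      rwa [hi]
    · intro H i hi
      exact lt_of_le_of_ne (H _ (((Φ v).w_mem_iff i k).2 hi.symm)) fun heq =>
        (Φ v).w_ne i (hinj ((Φ v).w_mem i) v.2 heq)
  rw [← Finset.card_sigma, ← Finset.card_univ]
  symm
  refine Finset.card_bij (fun p _ => (Φ p.1).F p.2) (fun _ _ => Finset.mem_univ _) ?_ ?_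
  · rintro ⟨v, k⟩ hv ⟨v', k'⟩ hv' heq
    simp only [Finset.mem_sigma, Finset.mem_univ, Finset.mem_filter, true_and, hlocal] at hv hv'
    simp only at heq
    have hk : k = k' := by rw [← (Φ v).color k, heq, (Φ v').color]
    subst hk
    have hvv : v = v' := Subtype.ext (hinj v.2 v'.2 (le_antisymm
      (hv' v (heq ▸ (Φ v).mem k)) (hv v' (heq ▸ (Φ v').mem k))))
    rw [hvv]
  · intro f _
    obtain ⟨v, hv, hvf, hmax⟩ := hP.exists_isMax_vertex f.2.1 f.2.2.1 h
    have := (Φ ⟨v, hv⟩).eq_of_mem f hvf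
    refine ⟨⟨⟨v, hv⟩, c f⟩, ?_, this⟩
    simp only [Finset.mem_sigma, Finset.mem_univ, Finset.mem_filter, true_and, hlocal]
    rwa [this]

open Classical in
theorem card_top_eq_one (hP : IsPolytope 3 P) [Fintype (vertices P)]
    (Φ : ∀ v : vertices P, VertexFrame P c v) (h : E →L[ℝ] ℝ) (hinj : Set.InjOn h (vertices P)) :
    (Finset.univ.filter fun v : vertices P => ∀ i, h ((Φ v).w i) < h v).card = 1 := by
  have hlocal : ∀ v : vertices P, (∀ i, h ((Φ v).w i) < h v) ↔ ∀ x ∈ P, h x ≤ h v := by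
    intro v
    constructor
    · intro H x hx
      exact (Φ v).le_of_mem h (s := Set.univ) (fun i _ => (H i).le) hx fun i hi =>
        (hi (Set.mem_univ i)).elim
    · intro H i
      exact lt_of_le_of_ne (H _ ((Φ v).w_mem i).1) fun heq =>
        (Φ v).w_ne i (hinj ((Φ v).w_mem i) v.2 heq)
  obtain ⟨v, hv, -, hmax⟩ := hP.exists_isMax_vertex (IsExposed.refl P) hP.nonempty h
  rw [Finset.card_eq_one]
  refine ⟨⟨v, hv⟩, ?_⟩
  ext u
  simp only [hlocal, Finset.mem_filter, Finset.mem_univ, true_and, Finset.mem_singleton]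
  refine ⟨fun H => Subtype.ext (hinj u.2 hv (le_antisymm (hmax _ u.2.1) (H _ hv.1))), ?_⟩
  rintro rfl
  exact hmax

/-- With `D i` telling whether edge `i` descends, this counts the facets at a vertex that have it as
top or as bottom: one in general, three at the top or bottom of the polytope. -/
theorem card_filter_fin_three (D : Fin 3 → Bool) :
    (Finset.univ.filter fun k => ∀ i, i ≠ k → D i = true).card +
      (Finset.univ.filter fun k => ∀ i, i ≠ k → D i = false).card =
    1 + 2 * (if ∀ i, D i = true then 1 else 0) + 2 * (if ∀ i, D i = false then 1 else 0) := by
  revert D; decide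

/-- Euler's formula for simple 3-polytopes. -/
theorem two_mul_card_facets [FiniteDimensional ℝ E] (hP : IsPolytope 3 P) [Fintype (vertices P)] [Fintype (facets P)]
    (Φ : ∀ v : vertices P, VertexFrame P c v) :
    2 * Fintype.card (facets P) = Fintype.card (vertices P) + 4 := by
  classical
  obtain ⟨h, hinj⟩ := exists_injOn_functional hP.finite_vertices
  have hinj' : Set.InjOn (-h) (vertices P) := fun x hx y hy hxy =>
    hinj hx hy (neg_injective (by simpa using hxy))
  have e1 := card_facets_eq_sum hP Φ h hinj
  have e2 := card_facets_eq_sum hP Φ (-h) hinj'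
  have e3 := card_top_eq_one hP Φ h hinj
  have e4 := card_top_eq_one hP Φ (-h) hinj'
  have hne : ∀ (v : vertices P) i, h ((Φ v).w i) ≠ h v := fun v i heq =>
    (Φ v).w_ne i (hinj ((Φ v).w_mem i) v.2 heq)
  have hflip : ∀ (v : vertices P) i, (-h) ((Φ v).w i) < (-h) v ↔ ¬ h ((Φ v).w i) < h v := by
    intro v i
    simp only [neg_apply, neg_lt_neg_iff, not_lt]
    exact ⟨le_of_lt, fun H => lt_of_le_of_ne H (hne v i).symm⟩
  simp only [hflip] at e2 e4
  rw [Finset.card_filter] at e3 e4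
  -- Summed over all vertices, the left side counts every facet twice, by its top and its bottom;
  -- the right side is the number of vertices plus 2 + 2.
  have key : ∀ v : vertices P,
      (Finset.univ.filter fun k => ∀ i, i ≠ k → h ((Φ v).w i) < h v).card +
      (Finset.univ.filter fun k => ∀ i, i ≠ k → ¬ h ((Φ v).w i) < h v).card =
      1 + 2 * (if ∀ i, h ((Φ v).w i) < h v then 1 else 0) +
        2 * (if ∀ i, ¬ h ((Φ v).w i) < h v then 1 else 0) := by
    intro v
    have := card_filter_fin_three fun i => decide (h ((Φ v).w i) < h v)
    simpa only [decide_eq_true_eq, decide_eq_false_iff_not] using this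
  have := Finset.sum_congr (rfl : (Finset.univ : Finset (vertices P)) = _) fun v _ => key v
  simp only [Finset.sum_add_distrib, ← Finset.mul_sum, Finset.sum_const, Finset.card_univ,
    smul_eq_mul, mul_one] at this
  rw [← e1, ← e2, e3, e4] at this
  omega

end Euler

theorem VertexFrame.sum_incidence [Fintype (facets P)] (v : vertices P) (Φ : VertexFrame P c v)
    (a : facets P → ℝ) : (∑ f, a f • incidenceVector P f) v = ∑ k, a (Φ.F k) := by
  rw [Finset.sum_apply]
  symm
  refine Finset.sum_of_injOn Φ.F (fun i _ j _ hij => ?_) (fun _ _ => Finset.mem_coe.2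
    (Finset.mem_univ _)) (fun f _ hf => ?_) fun k _ => ?_
  · rw [← Φ.color i, hij, Φ.color]
  · have : (v : E) ∉ (f : Set E) := fun h => hf ⟨c f, by simp, Φ.eq_of_mem f h⟩
    simp [incidenceVector, this]
  · simp [incidenceVector, Φ.mem k]

/-- The linear dependences of the incidence vectors are constant on the color classes. -/
theorem sum_smul_incidenceVector_eq_zero_iff [FiniteDimensional ℝ E] (hP : IsPolytope 3 P) [Fintype (facets P)]
    (Φ : ∀ v : vertices P, VertexFrame P c v) (a : facets P → ℝ) :
    ∑ f, a f • incidenceVector P f = 0 ↔ ∃ α : Fin 3 → ℝ, ∑ k, α k = 0 ∧ ∀ f, a f = α (c f) := by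
  have hsum : ∑ f, a f • incidenceVector P f = 0 ↔
      ∀ v : vertices P, ∑ k, a ((Φ v).F k) = 0 := by
    rw [funext_iff]
    exact forall_congr' fun v => by rw [(Φ v).sum_incidence, Pi.zero_apply]
  rw [hsum]
  constructor
  · intro H
    obtain ⟨h, hinj⟩ := exists_injOn_functional hP.finite_vertices
    obtain ⟨u, hu, -, hmax⟩ := hP.exists_isMax_vertex (IsExposed.refl P) hP.nonempty h
    -- Take the highest vertex whose values differ from those at the top `u`. Some edge ascends from
    -- it, to a vertex that already agrees with `u`. The two facets along this edge are shared, and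
    -- the relations at both ends equate the values of the third ones.
    have key : ∀ v : vertices P, ∀ k, a ((Φ v).F k) = a ((Φ ⟨u, hu⟩).F k) := by
      by_contra! hcon
      have := hP.finite_vertices.to_subtype
      obtain ⟨v, ⟨k, hk⟩, hvmax⟩ := Set.exists_max_image
        {v : vertices P | ∃ k, a ((Φ v).F k) ≠ a ((Φ ⟨u, hu⟩).F k)} (fun v => h v)
        (Set.toFinite _) hcon
      have hvu : (v : E) ≠ u := fun h => hk (by
        have : v = ⟨u, hu⟩ := Subtype.ext h
        rw [this])
      have hlt : h v < h u := lt_of_le_of_ne (hmax _ v.2.1) fun h => hvu (hinj v.2 hu h)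
      obtain ⟨j, hj⟩ : ∃ j, h v < h ((Φ v).w j) := by
        by_contra! H'
        exact hlt.not_ge ((Φ v).le_of_mem h (s := Set.univ) (fun i _ => H' i) hu.1 fun i hi =>
          (hi (Set.mem_univ i)).elim)
      let y : vertices P := ⟨(Φ v).w j, (Φ v).w_mem j⟩
      have hy : ∀ k, a ((Φ y).F k) = a ((Φ ⟨u, hu⟩).F k) := by
        by_contra! hy
        exact hj.not_ge (hvmax y hy)
      have hvy : ∀ i, i ≠ j → a ((Φ v).F i) = a ((Φ y).F i) := fun i hi => by
        have := (Φ y).eq_of_mem ((Φ v).F i) (((Φ v).w_mem_iff j i).2 hi)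
        rw [(Φ v).color] at this
        rw [this]
      have h1 := H v
      rw [← H y, ← Finset.add_sum_erase _ _ (Finset.mem_univ j),
        ← Finset.add_sum_erase _ _ (Finset.mem_univ j),
        Finset.sum_congr rfl fun i hi => hvy i (Finset.ne_of_mem_erase hi)] at h1
      have h2 := add_right_cancel h1
      by_cases hkj : k = j
      · exact hk (by rw [hkj, h2, hy])
      · exact hk (by rw [hvy k hkj, hy])
    refine ⟨fun k => a ((Φ ⟨u, hu⟩).F k), H _, fun f => ?_⟩
    obtain ⟨v, hv, hvf, -⟩ := hP.exists_isMax_vertex f.2.1 f.2.2.1 h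
    beta_reduce
    rw [← key ⟨v, hv⟩, (Φ ⟨v, hv⟩).eq_of_mem f hvf]
  · rintro ⟨α, hα, h⟩ v
    simpa [h, (Φ v).color] using hα

end Coloring

/-! ### Faces and dimensions from affine dependences -/

section Family

theorem le_of_mem_convexHull_range {ι W : Type*} [AddCommGroup W] [Module ℝ W] {x : ι → W} {l : Module.Dual ℝ W} {b : ℝ}
    (hb : ∀ i, l (x i) ≤ b) : ∀ z ∈ convexHull ℝ (Set.range x), l z ≤ b := by
  have : convexHull ℝ (Set.range x) ⊆ {z | l z ≤ b} :=
    convexHull_min (by rintro _ ⟨i, rfl⟩; exact hb i) (convex_halfSpace_le l.isLinear b)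
  exact fun z hz => this hz

variable {ι W : Type*} [Fintype ι] [AddCommGroup W] [Module ℝ W]

/-- `a` is an affine dependence of the finite family `x`. -/
def IsDep (x : ι → W) (a : ι → ℝ) : Prop := ∑ i, a i = 0 ∧ ∑ i, a i • x i = 0

/-- The linear map whose kernel is the space of affine dependences. -/
noncomputable def depMap (x : ι → W) : (ι → ℝ) →ₗ[ℝ] W × ℝ :=
  (Fintype.linearCombination ℝ x).prod (Fintype.linearCombination ℝ (1 : ι → ℝ))

theorem mem_ker_depMap {x : ι → W} {a : ι → ℝ} : a ∈ LinearMap.ker (depMap x) ↔ IsDep x a := by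
  simp [depMap, IsDep, Fintype.linearCombination_apply, and_comm]

/-- Values orthogonal to all affine dependences are the values of an affine function. -/
theorem exists_affine_of_orthogonal (x : ι → W) (y : ι → ℝ)
    (hy : ∀ a, IsDep x a → ∑ i, a i * y i = 0) :
    ∃ (l : Module.Dual ℝ W) (b : ℝ), ∀ i, l (x i) + b = y i := by
  classical
  -- A functional that kills the kernel of `depMap` factors through it; the factor on `W × ℝ` is the
  -- affine function.
  have h : Fintype.linearCombination ℝ y ∈ (LinearMap.ker (depMap x)).dualAnnihilator := by
    rw [Submodule.mem_dualAnnihilator]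
    intro a ha
    simpa [Fintype.linearCombination_apply] using hy a (mem_ker_depMap.1 ha)
  rw [← LinearMap.range_dualMap_eq_dualAnnihilator_ker] at h
  obtain ⟨φ, hφ⟩ := h
  refine ⟨φ.comp (LinearMap.inl ℝ W ℝ), φ (0, 1), fun i => ?_⟩
  have := LinearMap.congr_fun hφ (Pi.single i 1)
  simp only [depMap, LinearMap.dualMap_apply, LinearMap.prod_apply,
    Fintype.linearCombination_apply_single, one_smul] at this
  rw [← this, LinearMap.comp_apply, LinearMap.inl_apply, ← map_add]
  simp

theorem IsDep.sum_mul {x : ι → W} {a : ι → ℝ} (ha : IsDep x a) (l : Module.Dual ℝ W) (b : ℝ) :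
    ∑ i, a i * (b - l (x i)) = 0 := by
  have h := congrArg l ha.2
  simp only [map_sum, map_smul, smul_eq_mul, map_zero] at h
  simp only [mul_sub, Finset.sum_sub_distrib, h, ← Finset.sum_mul, ha.1, zero_mul, sub_zero]

/-- The index set of the points in some face of the convex hull of the family. -/
def IsFacial (x : ι → W) (J : Set ι) : Prop :=
  ∃ y : ι → ℝ, (∀ i, 0 ≤ y i) ∧ (∀ a, IsDep x a → ∑ i, a i * y i = 0) ∧ ∀ i, i ∈ J ↔ y i = 0

theorem mem_convexHull_range {x : ι → W} {z : W} (hz : z ∈ convexHull ℝ (Set.range x)) :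
    ∃ w : ι → ℝ, (∀ i, 0 ≤ w i) ∧ ∑ i, w i = 1 ∧ ∑ i, w i • x i = z := by
  have : convexHull ℝ (Set.range x) ⊆
      {z | ∃ w : ι → ℝ, (∀ i, 0 ≤ w i) ∧ ∑ i, w i = 1 ∧ ∑ i, w i • x i = z} := by
    classical
    refine convexHull_min ?_ ?_
    · rintro _ ⟨i, rfl⟩
      refine ⟨Pi.single i 1, fun j => ?_, by simp, ?_⟩
      · by_cases h : j = i
        · subst h; simp
        · simp [h]
      · rw [Finset.sum_eq_single i] <;> simp +contextual
    · rintro _ ⟨w, hw, hw1, rfl⟩ _ ⟨w', hw', hw1', rfl⟩ s t hs ht hst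
      refine ⟨fun i => s * w i + t * w' i, fun i => ?_, ?_, ?_⟩
      · have := hw i
        have := hw' i
        positivity
      · rw [Finset.sum_add_distrib, ← Finset.mul_sum, ← Finset.mul_sum, hw1, hw1']
        linarith
      · simp only [add_smul, Finset.sum_add_distrib, mul_smul, Finset.smul_sum]
  exact this hz

/-- In a convex combination that attains the bound `b`, points strictly below the level have weight
zero. -/
theorem convexHull_inter_level (x : ι → W) (l : Module.Dual ℝ W) (b : ℝ)
    (hb : ∀ i, l (x i) ≤ b) :
    {z | z ∈ convexHull ℝ (Set.range x) ∧ l z = b} = convexHull ℝ (x '' {i | l (x i) = b}) := by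
  classical
  apply Set.Subset.antisymm
  · rintro z ⟨hz, hlz⟩
    obtain ⟨w, hw, hw1, rfl⟩ := mem_convexHull_range hz
    have h0 : ∑ i, w i * (b - l (x i)) = 0 := by
      simp only [map_sum, map_smul, smul_eq_mul] at hlz
      simp only [mul_sub, Finset.sum_sub_distrib, ← Finset.sum_mul, hw1, hlz]
      ring
    rw [Finset.sum_eq_zero_iff_of_nonneg fun i _ =>
      mul_nonneg (hw i) (sub_nonneg.2 (hb i))] at h0
    have h1 : ∀ i, w i ≠ 0 → l (x i) = b := fun i hi => by
      rcases mul_eq_zero.1 (h0 i (Finset.mem_univ i)) with h | h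
      · exact (hi h).elim
      · linarith
    rw [← Finset.sum_filter_of_ne (p := fun i => l (x i) = b)
      fun i _ hi => h1 i fun h => hi (by rw [h, zero_smul])]
    refine (convex_convexHull ℝ _).sum_mem (fun i _ => hw i) ?_ fun i hi =>
      subset_convexHull ℝ _ ⟨i, (Finset.mem_filter.1 hi).2, rfl⟩
    rw [Finset.sum_filter_of_ne fun i _ hi => h1 i hi, hw1]
  · refine convexHull_min ?_ ((convex_convexHull ℝ _).inter (convex_hyperplane l.isLinear b))
    rintro _ ⟨i, hi, rfl⟩
    exact ⟨subset_convexHull ℝ _ ⟨i, rfl⟩, hi⟩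

theorem isFacial_of_functional (x : ι → W) (l : Module.Dual ℝ W) (b : ℝ)
    (hb : ∀ i, l (x i) ≤ b) : IsFacial x {i | l (x i) = b} :=
  ⟨fun i => b - l (x i), fun i => sub_nonneg.2 (hb i), fun _ ha => ha.sum_mul l b, fun i => by
    rw [Set.mem_ofPred_eq, sub_eq_zero, eq_comm]⟩

theorem IsFacial.exists_functional {x : ι → W} {J : Set ι} (hJ : IsFacial x J) :
    ∃ (l : Module.Dual ℝ W) (b : ℝ), (∀ i, l (x i) ≤ b) ∧ J = {i | l (x i) = b} := by
  obtain ⟨y, hy, horth, hJy⟩ := hJ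
  obtain ⟨l, b, hlb⟩ := exists_affine_of_orthogonal x y horth
  refine ⟨-l, b, fun i => ?_, ?_⟩
  · have := hy i
    rw [← hlb i] at this
    rw [LinearMap.neg_apply]
    linarith
  · ext i
    rw [hJy, ← hlb, Set.mem_ofPred_eq, LinearMap.neg_apply, neg_eq_iff_add_eq_zero]

/-- Facial sets contain every index whose point lies on the face, so a face determines its index
set; this makes `faceIso` bijective. -/
theorem IsFacial.mem_iff {x : ι → W} {J : Set ι} (hJ : IsFacial x J) (i : ι) :
    x i ∈ convexHull ℝ (x '' J) ↔ i ∈ J := by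
  obtain ⟨l, b, hlb, rfl⟩ := hJ.exists_functional
  rw [← convexHull_inter_level x l b hlb]
  exact ⟨fun h => h.2, fun h => ⟨subset_convexHull ℝ _ ⟨i, rfl⟩, h⟩⟩

theorem isFacial_univ (x : ι → W) : IsFacial x Set.univ :=
  ⟨0, fun _ => le_rfl, fun _ _ => by simp, fun _ => by simp⟩

theorem isFacial_empty (x : ι → W) : IsFacial x ∅ :=
  ⟨1, fun _ => zero_le_one, fun _ ha => by simpa using ha.1, fun _ => by simp⟩

section Topology

theorem eq_convexHull_of_isExposed [TopologicalSpace W] {x : ι → W} {F : Set W}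
    (hF : IsExposed ℝ (convexHull ℝ (Set.range x)) F) :
    IsFacial x {i | x i ∈ F} ∧ F = convexHull ℝ (x '' {i | x i ∈ F}) := by
  rcases F.eq_empty_or_nonempty with rfl | hne
  · simpa using isFacial_empty x
  · obtain ⟨l, hl⟩ := hF hne
    obtain ⟨z, hz⟩ := hne
    have hz' := hz
    rw [hl] at hz'
    have hb : ∀ i, (l : W →ₗ[ℝ] ℝ) (x i) ≤ l z :=
      fun i => hz'.2 _ (subset_convexHull ℝ _ ⟨i, rfl⟩)
    have hFl : F = {u | u ∈ convexHull ℝ (Set.range x) ∧ (l : W →ₗ[ℝ] ℝ) u = l z} := by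
      rw [hl]
      ext u
      exact and_congr_right fun hu => ⟨fun h => le_antisymm (hz'.2 u hu) (h z hz'.1),
        fun h y hy => (hz'.2 y hy).trans h.ge⟩
    have hJ : {i | x i ∈ F} = {i | (l : W →ₗ[ℝ] ℝ) (x i) = l z} := by
      ext i
      rw [hFl]
      exact ⟨fun h => h.2, fun h => ⟨subset_convexHull ℝ _ ⟨i, rfl⟩, h⟩⟩
    rw [hJ]
    exact ⟨isFacial_of_functional x _ _ hb, by rw [← convexHull_inter_level x _ _ hb, ← hFl]⟩

variable [TopologicalSpace W] [IsTopologicalAddGroup W] [ContinuousSMul ℝ W] [T2Space W]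
  [FiniteDimensional ℝ W]

theorem IsFacial.isExposed {x : ι → W} {J : Set ι} (hJ : IsFacial x J) :
    IsExposed ℝ (convexHull ℝ (Set.range x)) (convexHull ℝ (x '' J)) := by
  intro hne
  obtain ⟨l, b, hlb, rfl⟩ := hJ.exists_functional
  refine ⟨l.toContinuousLinearMap, ?_⟩
  rw [← convexHull_inter_level x l b hlb] at hne ⊢
  obtain ⟨z, hz, hzb⟩ := hne
  ext u
  simp only [Set.mem_ofPred_eq, LinearMap.coe_toContinuousLinearMap']
  refine and_congr_right fun hu => ⟨fun h y hy => h ▸ le_of_mem_convexHull_range hlb y hy,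
    fun h => le_antisymm (le_of_mem_convexHull_range hlb u hu) (hzb ▸ h z hz)⟩

/-- The face lattice of the convex hull of a finite family. -/
def faceIso (x : ι → W) :
    {F : Set W // IsFace (convexHull ℝ (Set.range x)) F} ≃o {J : Set ι // IsFacial x J} where
  toFun F := ⟨{i | x i ∈ F.1}, (eq_convexHull_of_isExposed F.2).1⟩
  invFun J := ⟨convexHull ℝ (x '' J.1), J.2.isExposed⟩
  left_inv F := Subtype.ext (eq_convexHull_of_isExposed F.2).2.symm
  right_inv J := Subtype.ext (Set.ext fun i => J.2.mem_iff i)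
  map_rel_iff' {F G} := by
    change {i | x i ∈ F.1} ⊆ {i | x i ∈ G.1} ↔ F.1 ⊆ G.1
    refine ⟨fun h => ?_, fun h i hi => h hi⟩
    rw [(eq_convexHull_of_isExposed F.2).2, (eq_convexHull_of_isExposed G.2).2]
    exact convexHull_mono (Set.image_mono h)

theorem combEquiv_of_isFacial_iff {ι' W' : Type*} [Fintype ι'] [AddCommGroup W'] [Module ℝ W']
    [TopologicalSpace W'] [IsTopologicalAddGroup W'] [ContinuousSMul ℝ W'] [T2Space W']
    [FiniteDimensional ℝ W'] {x : ι → W} {x' : ι' → W'} (e : ι ≃ ι')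
    (h : ∀ J, IsFacial x J ↔ IsFacial x' (e '' J)) :
    CombEquiv (convexHull ℝ (Set.range x)) (convexHull ℝ (Set.range x')) := by
  let f : {J : Set ι // IsFacial x J} ≃o {J : Set ι' // IsFacial x' J} :=
    { toEquiv := (Equiv.Set.congr e).subtypeEquiv h
      map_rel_iff' := fun {A B} => Set.image_subset_image_iff e.injective }
  exact ⟨(faceIso x).trans (f.trans (faceIso x').symm)⟩

end Topology

section Dimension

theorem affineIndependent_of_isDep (x : ι → W) (J : Set ι)
    (h : ∀ a, IsDep x a → (∀ i ∉ J, a i = 0) → a = 0) :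
    AffineIndependent ℝ fun i : J => x i := by
  classical
  rw [affineIndependent_iff]
  intro s w hw hwx e he
  -- The given weights, extended by zero to all of `ι`.
  set a : ι → ℝ := fun i => ∑ e ∈ s, if (e : ι) = i then w e else 0 with ha
  have hdep : IsDep x a := by
    constructor
    · rw [Finset.sum_comm]
      simpa using hw
    · simp only [ha, Finset.sum_smul]
      rw [Finset.sum_comm]
      simpa [ite_smul] using hwx
  have h0 := h a hdep fun i hi => Finset.sum_eq_zero fun e _ => by
    rw [if_neg]
    rintro rfl
    exact hi e.2
  have := congrFun h0 e
  simpa [ha, Subtype.coe_inj, Finset.sum_ite_eq', he] using this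

theorem dim_convexHull (s : Set W) : dim (convexHull ℝ s) = dim s := by
  rw [dim, dim, vectorSpan_convexHull]

theorem dim_image_of_affineIndependent {x : ι → W} {J : Set ι}
    (h : AffineIndependent ℝ fun i : J => x i) (hne : J.Nonempty) :
    dim (x '' J) + 1 = J.ncard := by
  classical
  have := hne.to_subtype
  have := h.finrank_vectorSpan_add_one
  rw [dim, Set.image_eq_range, this, ← Nat.card_eq_fintype_card, Nat.card_coe_set_eq]

theorem isSimplex_of_affineIndependent {x : ι → W} {J : Set ι}
    (h : AffineIndependent ℝ fun i : J => x i) : IsSimplex (convexHull ℝ (x '' J)) := by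
  have hfin : (x '' J).Finite := Set.toFinite _
  refine ⟨hfin.toFinset, ?_, by simp⟩
  have h2 := h.range
  rw [← Set.image_eq_range] at h2
  convert h2 <;> simp

/-- The affine dependences of `x` are the multiples of `c`. -/
structure IsCircuit (x : ι → W) (c : ι → ℝ) : Prop where
  ne_zero : c ≠ 0
  isDep_iff : ∀ a, IsDep x a ↔ ∃ r : ℝ, a = r • c

variable {x : ι → W} {c : ι → ℝ}

theorem IsCircuit.isDep (h : IsCircuit x c) : IsDep x c := (h.isDep_iff c).2 ⟨1, (one_smul ℝ c).symm⟩

theorem IsCircuit.affineIndependent (h : IsCircuit x c) {J : Set ι} {j : ι} (hj : j ∉ J)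
    (hcj : c j ≠ 0) : AffineIndependent ℝ fun i : J => x i := by
  refine affineIndependent_of_isDep x J fun a ha h0 => ?_
  obtain ⟨r, rfl⟩ := (h.isDep_iff a).1 ha
  have := h0 j hj
  simp only [Pi.smul_apply, smul_eq_mul, mul_eq_zero, hcj, or_false] at this
  rw [this, zero_smul]

/-- An index of the support can be dropped: its point is an affine combination of the others, with
coefficients `-(c i / c j)`, and these are independent. So the dimension is two less than the number
of points. -/
theorem IsCircuit.dim_add_two (h : IsCircuit x c) {J : Set ι} (hJ : ∀ i, c i ≠ 0 → i ∈ J) :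
    dim (x '' J) + 2 = J.ncard := by
  classical
  obtain ⟨j, hj⟩ := Function.ne_iff.1 h.ne_zero
  rw [Pi.zero_apply] at hj
  have hjJ := hJ j hj
  have hind := h.affineIndependent (J := J \ {j}) (by simp) hj
  have hsum : ∑ i ∈ Finset.univ.erase j, -(c i / c j) = 1 := by
    rw [Finset.sum_neg_distrib, ← Finset.sum_div]
    have := Finset.add_sum_erase Finset.univ c (Finset.mem_univ j)
    rw [h.isDep.1] at this
    rw [← neg_div, div_eq_one_iff_eq hj]
    linarith
  have hxj : x j ∈ affineSpan ℝ (x '' (J \ {j})) := by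
    have hmem := affineCombination_mem_affineSpan_image (k := ℝ) hsum (s' := J \ {j})
      (fun i hi hi' => ?_) x
    · rw [Finset.affineCombination_eq_linear_combination _ _ _ hsum] at hmem
      convert hmem
      have := Finset.add_sum_erase Finset.univ (fun i => c i • x i) (Finset.mem_univ j)
      rw [h.isDep.2, add_eq_zero_iff_eq_neg] at this
      rw [← inv_smul_smul₀ hj (x j), this, ← Finset.sum_neg_distrib, Finset.smul_sum]
      refine Finset.sum_congr rfl fun i _ => ?_
      rw [smul_neg, smul_smul, ← neg_smul, div_eq_inv_mul]
    · by_cases hci : c i = 0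
      · simp [hci]
      · exact (hi' ⟨hJ i hci, by simpa using hi⟩).elim
  have hne : (J \ {j}).Nonempty := by
    by_contra! hemp
    rw [hemp] at hxj
    rw [Set.image_empty, AffineSubspace.span_empty] at hxj
    exact AffineSubspace.notMem_bot ℝ W _ hxj
  have hdim := dim_image_of_affineIndependent hind hne
  have hspan : affineSpan ℝ (x '' J) = affineSpan ℝ (x '' (J \ {j})) := by
    rw [← affineSpan_insert_eq_affineSpan ℝ hxj, ← Set.image_insert_eq, Set.insert_sdiff_singleton,
      Set.insert_eq_of_mem hjJ]
  have hdim' : dim (x '' J) = dim (x '' (J \ {j})) := by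
    rw [dim, dim, ← direction_affineSpan, hspan, direction_affineSpan]
  have := Set.ncard_sdiff_singleton_add_one hjJ (Set.toFinite _)
  omega

/-- By `IsCircuit.dim_add_two` a further point raises the dimension by one. -/
theorem IsCircuit.notMem_affineSpan (h : IsCircuit x c) {J : Set ι} (hJ : ∀ i, c i ≠ 0 → i ∈ J)
    {a : ι} (ha : a ∉ J) : x a ∉ affineSpan ℝ (x '' J) := by
  intro hmem
  have h1 := h.dim_add_two hJ
  have h2 := h.dim_add_two (J := insert a J) fun i hi => Or.inr (hJ i hi)
  rw [Set.ncard_insert_of_notMem ha (Set.toFinite _), Set.image_insert_eq, dim,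
    ← direction_affineSpan, affineSpan_insert_eq_affineSpan ℝ hmem, direction_affineSpan] at h2
  rw [dim] at h1
  omega

theorem IsCircuit.isPolytope (h : IsCircuit x c) {J : Set ι} (hJ : ∀ i, c i ≠ 0 → i ∈ J) {d : ℕ}
    (hd : J.ncard = d + 2) : IsPolytope d (convexHull ℝ (x '' J)) := by
  obtain ⟨j, hj⟩ := Function.ne_iff.1 h.ne_zero
  refine ⟨⟨x '' J, Set.toFinite _, ⟨_, j, hJ j hj, rfl⟩, rfl⟩, ?_⟩
  have := h.dim_add_two hJ
  rw [dim_convexHull]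
  omega

/-- The points outside the support of a circuit are the apices of a multiple pyramid. -/
theorem IsCircuit.isFoldPyramid (h : IsCircuit x c) (T : Finset ι) (hT : ∀ i ∈ T, c i = 0) {d : ℕ}
    (hd : ({i | c i ≠ 0} : Set ι).ncard = d + 2) :
    IsFoldPyramid T.card (d + T.card) (convexHull ℝ (x '' ({i | c i ≠ 0} ∪ T)))
      (convexHull ℝ (x '' {i | c i ≠ 0})) := by
  classical
  induction T using Finset.induction_on with
  | empty =>
    rw [Finset.coe_empty, Set.union_empty]
    exact ⟨rfl, h.isPolytope (J := {i | c i ≠ 0}) (fun i hi => hi) hd⟩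
  | insert a T ha ih =>
    have hca := hT a (Finset.mem_insert_self a T)
    have ih' := ih fun i hi => hT i (Finset.mem_insert_of_mem hi)
    have haJ : a ∉ ({i | c i ≠ 0} ∪ T : Set ι) := by simp [hca, ha]
    have hdisj : Disjoint {i | c i ≠ 0} (T : Set ι) := by
      rw [Set.disjoint_right]
      exact fun i hi hci => hci (hT i (Finset.mem_insert_of_mem hi))
    rw [Finset.card_insert_of_notMem ha]
    refine ⟨convexHull ℝ (x '' ({i | c i ≠ 0} ∪ T)), ⟨d + T.card, by ring, ?_, x a, ?_, ?_⟩, ?_⟩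
    · refine h.isPolytope (J := {i | c i ≠ 0} ∪ T) (fun i hi => Or.inl hi) ?_
      rw [Set.ncard_union_eq hdisj, hd, Set.ncard_coe_finset]
      ring
    · rw [affineSpan_convexHull]
      exact h.notMem_affineSpan (J := {i | c i ≠ 0} ∪ T) (fun i hi => Or.inl hi) haJ
    · rw [Finset.coe_insert, Set.union_insert, Set.image_insert_eq, Set.insert_eq, Set.insert_eq,
        convexHull_convexHull_union_right]
    · simpa [← add_assoc] using ih'

end Dimension

end Family

/-! ### Free sums of simplices -/

section FreeSum

variable {ι κ W : Type*} [Fintype ι] [Fintype κ] [AddCommGroup W] [Module ℝ W]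

/-- The affine dependences of `x` are those of a free sum of simplices: the classes of `c` are the
vertex sets of the simplices, and `μ` gives the barycentric coordinates of their common point. -/
structure IsFreeSum (x : ι → W) (c : ι → κ) (μ : ι → ℝ) : Prop where
  pos : ∀ i, 0 < μ i
  isDep_iff : ∀ a, IsDep x a ↔ ∃ α : κ → ℝ, ∑ k, α k = 0 ∧ ∀ i, a i = α (c i) * μ i

variable {x : ι → W} {c : ι → κ} {μ : ι → ℝ}

open Classical in
-- Pairing `y` with a dependence gives ∑ α_k S_k, where S_k is the weighted sum of `y` over class k.
-- This vanishes for all α of sum 0 iff the S_k are equal.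
theorem IsFreeSum.orthogonal_iff (h : IsFreeSum x c μ) (y : ι → ℝ) :
    (∀ a, IsDep x a → ∑ i, a i * y i = 0) ↔
      ∀ k k', ∑ i with c i = k, μ i * y i = ∑ i with c i = k', μ i * y i := by
  have hsum : ∀ (α : κ → ℝ) (a : ι → ℝ), (∀ i, a i = α (c i) * μ i) →
      ∑ i, a i * y i = ∑ k, α k * ∑ i with c i = k, μ i * y i := by
    intro α a ha
    rw [← Finset.sum_fiberwise Finset.univ c]
    refine Finset.sum_congr rfl fun k _ => ?_
    rw [Finset.mul_sum]
    refine Finset.sum_congr rfl fun i hi => ?_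
    rw [ha, (Finset.mem_filter.1 hi).2, mul_assoc]
  constructor
  · intro H k k'
    have hα : ∑ l, (Pi.single k 1 - Pi.single k' 1 : κ → ℝ) l = 0 := by simp
    have h1 := H _ ((h.isDep_iff _).2 ⟨_, hα, fun i => rfl⟩)
    rw [hsum _ _ fun i => rfl] at h1
    simp only [Pi.sub_apply, sub_mul, Finset.sum_sub_distrib, Pi.single_apply, ite_mul, one_mul,
      zero_mul, Finset.sum_ite_eq', Finset.mem_univ, if_true] at h1
    linarith
  · intro H a ha
    obtain ⟨α, hα, haα⟩ := (h.isDep_iff a).1 ha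
    rw [hsum α a haα]
    rcases isEmpty_or_nonempty κ with _ | ⟨⟨k₀⟩⟩
    · simp
    · rw [Finset.sum_congr rfl fun k _ => by rw [H k k₀], ← Finset.sum_mul, hα, zero_mul]

/-- The faces of a free sum of simplices. -/
theorem IsFreeSum.isFacial_iff (h : IsFreeSum x c μ) (J : Set ι) :
    IsFacial x J ↔ J = Set.univ ∨ ∀ k, ¬ c ⁻¹' {k} ⊆ J := by
  classical
  constructor
  · rintro ⟨y, hy, horth, hJ⟩
    rw [h.orthogonal_iff] at horth
    by_contra! hcon
    obtain ⟨hne, k, hk⟩ := hcon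
    refine hne (Set.eq_univ_of_forall fun i => (hJ i).2 ?_)
    -- A class inside `J` has weighted sum zero, hence so has every class; the terms are
    -- nonnegative, so all of them vanish.
    have h0 : ∑ j with c j = c i, μ j * y j = 0 := by
      rw [horth (c i) k]
      refine Finset.sum_eq_zero fun j hj => ?_
      rw [(hJ j).1 (hk (by simpa using hj)), mul_zero]
    rw [Finset.sum_eq_zero_iff_of_nonneg fun j _ => mul_nonneg (h.pos j).le (hy j)] at h0
    exact (mul_eq_zero.1 (h0 i (by simp))).resolve_left (h.pos i).ne'
  · rintro (rfl | hJ)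
    · exact isFacial_univ x
    · set N : κ → ℕ := fun k => (Finset.univ.filter fun i => c i = k ∧ i ∉ J).card with hN
      have hNpos : ∀ k, 0 < N k := fun k => by
        obtain ⟨i, hi, hiJ⟩ := Set.not_subset.1 (hJ k)
        exact Finset.card_pos.2 ⟨i, by simpa using ⟨hi, hiJ⟩⟩
      -- Off `J` the values are scaled so that each class has weighted sum 1.
      refine ⟨fun i => if i ∈ J then 0 else (μ i * N (c i))⁻¹, fun i => ?_, ?_, fun i => ?_⟩
      · have := h.pos i
        dsimp only
        split_ifs <;> positivity
      · rw [h.orthogonal_iff]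
        suffices hs : ∀ k, ∑ i with c i = k, μ i * (if i ∈ J then 0 else (μ i * N (c i))⁻¹) = 1 by
          intro k k'
          rw [hs, hs]
        intro k
        have hNk : (N k : ℝ) ≠ 0 := Nat.cast_ne_zero.2 (hNpos k).ne'
        have : ∀ i ∈ Finset.univ.filter fun i => c i = k,
            μ i * (if i ∈ J then 0 else (μ i * N (c i))⁻¹) =
              if i ∉ J then (N k : ℝ)⁻¹ else 0 := by
          intro i hi
          rw [(Finset.mem_filter.1 hi).2]
          have := (h.pos i).ne'
          by_cases hiJ : i ∈ J
          · simp [hiJ]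
          · simp only [hiJ, not_false_eq_true, if_true, if_false]
            field_simp
        rw [Finset.sum_congr rfl this, ← Finset.sum_filter, Finset.filter_filter, Finset.sum_const,
          nsmul_eq_mul]
        exact mul_inv_cancel₀ hNk
      · have h1 := (h.pos i).ne'
        have h2 : (N (c i) : ℝ) ≠ 0 := Nat.cast_ne_zero.2 (hNpos _).ne'
        by_cases hiJ : i ∈ J <;> simp [hiJ, h1, h2]

/-- A dependence supported in `J` vanishes at a point of each class outside `J`, so its constant on
that class is 0. -/
theorem IsFreeSum.affineIndependent (h : IsFreeSum x c μ) {J : Set ι}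
    (hJ : ∀ k, ¬ c ⁻¹' {k} ⊆ J) : AffineIndependent ℝ fun i : J => x i := by
  refine affineIndependent_of_isDep x J fun a ha h0 => ?_
  obtain ⟨α, -, haα⟩ := (h.isDep_iff a).1 ha
  ext i
  obtain ⟨j, hj, hjJ⟩ := Set.not_subset.1 (hJ (c i))
  have := h0 j hjJ
  rw [haα, Set.mem_singleton_iff.1 hj, mul_eq_zero] at this
  rw [haα, this.resolve_right (h.pos j).ne', zero_mul, Pi.zero_apply]

end FreeSum

/-! ### Point sets with a single dependence -/

section Circuit

variable {ι W : Type*} [Fintype ι] [AddCommGroup W] [Module ℝ W] {x : ι → W} {c : ι → ℝ}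

theorem IsSimplex.ncard_le {ι W : Type*} [Finite ι] [AddCommGroup W] [Module ℝ W] {x : ι → W} {J : Set ι} (hx : Function.Injective x)
    (hJ : x '' J ⊆ vertices (convexHull ℝ (x '' J))) (h : IsSimplex (convexHull ℝ (x '' J)))
    (hne : J.Nonempty) : J.ncard ≤ dim (x '' J) + 1 := by
  classical
  obtain ⟨s, hs, heq⟩ := h
  have hJs : x '' J ⊆ s := by
    refine hJ.trans ?_
    rw [heq]
    exact extremePoints_convexHull_subset
  have : Nonempty s := by
    obtain ⟨j, hj⟩ := hne
    exact ⟨x j, hJs ⟨j, hj, rfl⟩⟩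
  have h1 := hs.finrank_vectorSpan_add_one
  have h2 : Set.range (fun y : s => (y : W)) = (s : Set W) := by simp
  rw [h2, Fintype.card_coe] at h1
  have h3 : dim (x '' J) = dim (s : Set W) := by
    rw [← dim_convexHull, heq, dim_convexHull]
  rw [h3, dim, h1, ← Set.ncard_image_of_injective J hx, ← Set.ncard_coe_finset]
  exact Set.ncard_le_ncard hJs

theorem IsCircuit.not_isSimplex (h : IsCircuit x c) (hx : Function.Injective x)
    (hext : ∀ i, x i ∈ vertices (convexHull ℝ (Set.range x))) {J : Set ι}
    (hJ : ∀ i, c i ≠ 0 → i ∈ J) : ¬ IsSimplex (convexHull ℝ (x '' J)) := by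
  intro hs
  obtain ⟨j, hj⟩ := Function.ne_iff.1 h.ne_zero
  have h1 := hs.ncard_le hx (fun _ hu => by
    obtain ⟨i, hi, rfl⟩ := hu
    exact inter_extremePoints_subset_extremePoints_of_subset
      (convexHull_mono (Set.image_subset_range x J))
      ⟨subset_convexHull ℝ _ ⟨i, hi, rfl⟩, hext i⟩) ⟨j, hJ j hj⟩
  have h2 := h.dim_add_two hJ
  omega

theorem IsCircuit.subset_of_not_isSimplex (h : IsCircuit x c) {J : Set ι}
    (hs : ¬ IsSimplex (convexHull ℝ (x '' J))) : ∀ i, c i ≠ 0 → i ∈ J := by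
  intro i hi
  by_contra hiJ
  exact hs (isSimplex_of_affineIndependent (h.affineIndependent hiJ hi))

theorem IsCircuit.dim_range_add_two (h : IsCircuit x c) :
    dim (convexHull ℝ (Set.range x)) + 2 = Fintype.card ι := by
  have := h.dim_add_two (J := Set.univ) fun _ _ => Set.mem_univ _
  rwa [Set.image_univ, Set.ncard_univ, Nat.card_eq_fintype_card, ← dim_convexHull] at this

/-- The indicator of `i` is orthogonal to `c`, so all points but the apex `x i` lie on a common
face. -/
theorem IsCircuit.isFacial_compl (h : IsCircuit x c) {i : ι} (hi : c i = 0) :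
    IsFacial x {i}ᶜ := by
  classical
  refine ⟨Pi.single i 1, fun j => ?_, fun a ha => ?_, fun j => ?_⟩
  · by_cases hj : j = i
    · subst hj; simp
    · simp [hj]
  · obtain ⟨r, rfl⟩ := (h.isDep_iff a).1 ha
    simp [Pi.single_apply, hi]
  · by_cases hj : j = i
    · subst hj; simp
    · simp [hj]

section

variable [TopologicalSpace W] [IsTopologicalAddGroup W] [ContinuousSMul ℝ W] [T2Space W]
  [FiniteDimensional ℝ W]

/-- A face that is not a simplex contains the whole support. Its dimension is then its number of
points minus two, as for the whole polytope, so a facet of this kind omits exactly one point, an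
apex. -/
theorem IsCircuit.nonsimplex_facets (h : IsCircuit x c) (hx : Function.Injective x)
    (hext : ∀ i, x i ∈ vertices (convexHull ℝ (Set.range x))) :
    {F ∈ facets (convexHull ℝ (Set.range x)) | ¬ IsSimplex F} =
      (fun i => convexHull ℝ (x '' {i}ᶜ)) '' {i | c i = 0} := by
  have hdim := h.dim_range_add_two
  have hcompl : ∀ i : ι, ({i}ᶜ : Set ι).ncard + 1 = Fintype.card ι := fun i => by
    have := Set.ncard_add_ncard_compl ({i} : Set ι)
    rw [Set.ncard_singleton, Nat.card_eq_fintype_card] at this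
    omega
  ext F
  constructor
  · rintro ⟨⟨hF, -, hFd⟩, hFs⟩
    have hFeq := (eq_convexHull_of_isExposed hF).2
    set J := {i | x i ∈ F}
    rw [hFeq] at hFs hFd
    have hJ := h.subset_of_not_isSimplex hFs
    have h1 := h.dim_add_two hJ
    rw [dim_convexHull] at hFd
    have h2 := Set.ncard_add_ncard_compl J
    rw [Nat.card_eq_fintype_card] at h2
    obtain ⟨i, hi⟩ := Set.ncard_eq_one.1 (by omega : Jᶜ.ncard = 1)
    refine ⟨i, ?_, ?_⟩
    · by_contra hci
      have : i ∈ Jᶜ := hi ▸ Set.mem_singleton i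
      exact this (hJ i hci)
    · beta_reduce
      rw [← hi, compl_compl]
      exact hFeq.symm
  · rintro ⟨i, hi, rfl⟩
    have hsupp : ∀ j, c j ≠ 0 → j ∈ ({i}ᶜ : Set ι) := by
      rintro j hj rfl
      exact hj hi
    have h1 := h.dim_add_two hsupp
    obtain ⟨j, hj⟩ := Function.ne_iff.1 h.ne_zero
    refine ⟨⟨(h.isFacial_compl hi).isExposed, ⟨x j, subset_convexHull ℝ _ ⟨j, hsupp j hj, rfl⟩⟩,
      ?_⟩, h.not_isSimplex hx hext hsupp⟩
    have := hcompl i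
    rw [dim_convexHull]
    omega

theorem IsCircuit.ncard_nonsimplex_facets (h : IsCircuit x c) (hx : Function.Injective x)
    (hext : ∀ i, x i ∈ vertices (convexHull ℝ (Set.range x))) :
    {F ∈ facets (convexHull ℝ (Set.range x)) | ¬ IsSimplex F}.ncard =
      ({i | c i = 0} : Set ι).ncard := by
  rw [h.nonsimplex_facets hx hext]
  refine Set.InjOn.ncard_image fun i hi j hj hij => ?_
  by_contra hne
  have h1 := ((h.isFacial_compl hj).mem_iff i).2 hne
  rw [← show convexHull ℝ (x '' {i}ᶜ) = convexHull ℝ (x '' {j}ᶜ) from hij,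
    (h.isFacial_compl hi).mem_iff] at h1
  exact h1 rfl

/-- A point that is negative on the apices, and nonnegative on the support of the circuit, is
beyond exactly those facets that are not simplices. -/
theorem IsCircuit.isBeyond_iff (h : IsCircuit x c) (hx : Function.Injective x)
    (hext : ∀ i, x i ∈ vertices (convexHull ℝ (Set.range x))) {μ : ι → ℝ} (hμ1 : ∑ i, μ i = 1)
    (hneg : ∀ i, c i = 0 → μ i < 0) (hnn : ∀ i, c i ≠ 0 → 0 ≤ μ i) {F : Set W}
    (hF : F ∈ facets (convexHull ℝ (Set.range x))) :
    IsBeyond (∑ i, μ i • x i) (convexHull ℝ (Set.range x)) F ↔ ¬ IsSimplex F := by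
  classical
  have hlw : ∀ (l : Module.Dual ℝ W) (b : ℝ),
      l (∑ i, μ i • x i) = b - ∑ i, μ i * (b - l (x i)) := by
    intro l b
    simp only [map_sum, map_smul, smul_eq_mul, mul_sub, Finset.sum_sub_distrib, ← Finset.sum_mul,
      hμ1]
    ring
  constructor
  · rintro ⟨-, l, b, hlb, hFl, hlt⟩ hs
    have hb : ∀ i, (l : W →ₗ[ℝ] ℝ) (x i) ≤ b := fun i => hlb _ (subset_convexHull ℝ _ ⟨i, rfl⟩)
    set J := {i | (l : W →ₗ[ℝ] ℝ) (x i) = b} with hJ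
    have hFJ : F = convexHull ℝ (x '' J) :=
      hFl.trans (convexHull_inter_level x (l : W →ₗ[ℝ] ℝ) b hb)
    -- A simplex facet misses a point `j` of the support, so its points are independent, and
    -- counting dimensions shows that it misses exactly two points.
    obtain ⟨j, hj, hjJ⟩ : ∃ j, c j ≠ 0 ∧ j ∉ J := by
      by_contra! hcon
      exact h.not_isSimplex hx hext hcon (hFJ ▸ hs)
    have hJne : J.Nonempty := by
      have := hF.2.1
      rwa [hFJ, convexHull_nonempty_iff, Set.image_nonempty] at this
    have h1 := dim_image_of_affineIndependent (h.affineIndependent hjJ hj) hJne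
    have h2 := hF.2.2
    rw [hFJ, dim_convexHull] at h2
    have h3 := h.dim_range_add_two
    have h4 := Set.ncard_add_ncard_compl J
    rw [Nat.card_eq_fintype_card] at h4
    have h5 := h.isDep.sum_mul (l : W →ₗ[ℝ] ℝ) b
    have hzero : ∀ i, i ∉ J ↔ b - (l : W →ₗ[ℝ] ℝ) (x i) ≠ 0 := fun i => by
      rw [sub_ne_zero, ne_comm]; rfl
    -- `c` is orthogonal to the slacks `b - l (x i)`, so the slack at `j` must be balanced by
    -- another point of the support. As `μ` is nonnegative at both, the new point is not past the
    -- hyperplane.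
    obtain ⟨j', hj', hjj'⟩ : ∃ j' ∈ Finset.univ.erase j,
        c j' * (b - (l : W →ₗ[ℝ] ℝ) (x j')) ≠ 0 := by
      by_contra! hcon
      rw [← Finset.add_sum_erase _ _ (Finset.mem_univ j), Finset.sum_eq_zero hcon, add_zero] at h5
      exact mul_ne_zero hj ((hzero j).1 hjJ) h5
    have hsub : ({j, j'} : Set ι) = Jᶜ := by
      refine Set.eq_of_subset_of_ncard_le ?_ ?_
      · rintro i (rfl | rfl)
        exacts [hjJ, (hzero _).2 (right_ne_zero_of_mul hjj')]
      · rw [Set.ncard_pair (Finset.ne_of_mem_erase hj').symm]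
        omega
    have h6 : ∀ i, 0 ≤ μ i * (b - (l : W →ₗ[ℝ] ℝ) (x i)) := by
      intro i
      by_cases hiJ : i ∈ J
      · rw [not_not.1 (mt (hzero i).2 (not_not.2 hiJ)), mul_zero]
      · refine mul_nonneg (hnn i ?_) (sub_nonneg.2 (hb i))
        have : i ∈ ({j, j'} : Set ι) := hsub ▸ hiJ
        rcases this with rfl | rfl
        exacts [hj, left_ne_zero_of_mul hjj']
    have h7 : l (∑ i, μ i • x i) = b - ∑ i, μ i * (b - (l : W →ₗ[ℝ] ℝ) (x i)) :=
      hlw (l : W →ₗ[ℝ] ℝ) b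
    have h8 := Finset.sum_nonneg fun i (_ : i ∈ Finset.univ) => h6 i
    linarith
  -- The facet omits one apex `i`, the only point with a slack, and `μ i < 0` makes the slack of the
  -- new point negative.
  · intro hs
    have hFmem : F ∈ {F ∈ facets (convexHull ℝ (Set.range x)) | ¬ IsSimplex F} := ⟨hF, hs⟩
    rw [h.nonsimplex_facets hx hext] at hFmem
    obtain ⟨i, hi, rfl⟩ := hFmem
    obtain ⟨l, b, hlb, hJ⟩ := (h.isFacial_compl hi).exists_functional
    refine ⟨?_, l.toContinuousLinearMap, b, le_of_mem_convexHull_range hlb, ?_, ?_⟩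
    · rw [affineSpan_convexHull, ← Finset.affineCombination_eq_linear_combination _ _ _ hμ1]
      exact affineCombination_mem_affineSpan hμ1 x
    · beta_reduce
      rw [hJ]
      exact (convexHull_inter_level x l b hlb).symm
    · rw [LinearMap.coe_toContinuousLinearMap', hlw l b, Finset.sum_eq_single i]
      · have h1 : l (x i) ≠ b := fun hib => by
          have : i ∈ ({i}ᶜ : Set ι) := hJ ▸ hib
          exact this rfl
        have h2 := mul_neg_of_neg_of_pos (hneg i hi) (sub_pos.2 (lt_of_le_of_ne (hlb i) h1))
        linarith
      · intro j _ hji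
        have : j ∈ {j | l (x j) = b} := hJ ▸ hji
        rw [show l (x j) = b from this, sub_self, mul_zero]
      · simp

end

theorem sum_subtype_dite {M : Type*} [AddCommMonoid M] (p : ι → Prop) [DecidablePred p]
    (f : {i // p i} → M) : ∑ i, (if h : p i then f ⟨i, h⟩ else 0) = ∑ i, f i := by
  rw [← Fintype.sum_subtype_add_sum_subtype p]
  rw [Finset.sum_congr rfl fun (i : {i // p i}) _ => dif_pos i.2,
    Finset.sum_eq_zero fun (i : {i // ¬ p i}) _ => dif_neg i.2, add_zero]

theorem isDep_subtype_iff (x : ι → W) (p : ι → Prop) [DecidablePred p] (a : {i // p i} → ℝ) :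
    IsDep (fun i : {i // p i} => x i) a ↔ IsDep x fun i => if h : p i then a ⟨i, h⟩ else 0 := by
  have h1 := sum_subtype_dite p a
  have h2 := sum_subtype_dite p fun i => a i • x i
  rw [IsDep, IsDep, h1, ← h2]
  refine and_congr_right fun _ => Eq.congr ?_ rfl
  refine Finset.sum_congr rfl fun i _ => ?_
  split_ifs <;> simp

theorem IsCircuit.subtype_support [DecidablePred fun i => c i ≠ 0] (h : IsCircuit x c) :
    IsCircuit (fun i : {i // c i ≠ 0} => x i) fun i => c i := by
  refine ⟨fun h0 => h.ne_zero ?_, fun a => ?_⟩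
  · ext i
    by_contra hi
    exact hi (congrFun h0 ⟨i, hi⟩)
  · rw [isDep_subtype_iff x, h.isDep_iff]
    refine exists_congr fun r => ?_
    rw [funext_iff, funext_iff, Subtype.forall]
    refine forall_congr' fun i => ?_
    by_cases hi : c i = 0 <;> simp [hi]

/-- Radon's theorem: the simplices on the positive and on the negative points meet in one point,
with weights proportional to `|c i|`. -/
theorem IsCircuit.isFreeSum (h : IsCircuit x c) (hc : ∀ i, c i ≠ 0) :
    IsFreeSum x (fun i => decide (0 < c i)) fun i => |c i| := by
  refine ⟨fun i => abs_pos.2 (hc i), fun a => ?_⟩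
  rw [h.isDep_iff]
  constructor
  · rintro ⟨r, rfl⟩
    refine ⟨fun b => if b then r else -r, by simp, fun i => ?_⟩
    rcases lt_or_gt_of_ne (hc i) with hi | hi
    · simp [hi.not_gt, abs_of_neg hi]
    · simp [hi, abs_of_pos hi]
  · rintro ⟨α, hα, ha⟩
    refine ⟨α true, funext fun i => ?_⟩
    rw [Fintype.sum_bool] at hα
    rw [ha, Pi.smul_apply, smul_eq_mul]
    rcases lt_or_gt_of_ne (hc i) with hi | hi
    · simp only [hi.not_gt, decide_false, abs_of_neg hi]
      rw [eq_neg_of_add_eq_zero_left hα]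
      ring
    · simp [hi, abs_of_pos hi]

/-- Two circuits with full support and equally many points on both sides. -/
theorem IsCircuit.combEquiv [TopologicalSpace W] [IsTopologicalAddGroup W] [ContinuousSMul ℝ W] [T2Space W]
    [FiniteDimensional ℝ W] {ι' W' : Type*} [Fintype ι'] [AddCommGroup W'] [Module ℝ W']
    [TopologicalSpace W'] [IsTopologicalAddGroup W'] [ContinuousSMul ℝ W'] [T2Space W']
    [FiniteDimensional ℝ W'] {x' : ι' → W'} {c' : ι' → ℝ} (h : IsCircuit x c)
    (hc : ∀ i, c i ≠ 0) (h' : IsCircuit x' c') (hc' : ∀ i, c' i ≠ 0)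
    (hcard : ∀ b, Nat.card {i // decide (0 < c i) = b} = Nat.card {i // decide (0 < c' i) = b}) :
    CombEquiv (convexHull ℝ (Set.range x)) (convexHull ℝ (Set.range x')) := by
  -- Any bijection that matches signs will do: the faces of a free sum depend only on its classes.
  let e : ι ≃ ι' := Equiv.ofFiberEquiv (f := fun i => decide (0 < c i))
    (g := fun i => decide (0 < c' i)) fun b => (Finite.card_eq.1 (hcard b)).some
  have he : ∀ i, decide (0 < c' (e i)) = decide (0 < c i) := fun i =>
    Equiv.ofFiberEquiv_map (f := fun i => decide (0 < c i)) (g := fun i => decide (0 < c' i)) _ i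
  refine combEquiv_of_isFacial_iff e fun J => ?_
  rw [(h.isFreeSum hc).isFacial_iff, (h'.isFreeSum hc').isFacial_iff]
  refine or_congr ?_ (forall_congr' fun k => not_congr ?_)
  · rw [← Set.image_univ_of_surjective e.surjective]
    exact (Set.image_injective.2 e.injective).eq_iff.symm
  · constructor
    · intro H i' hi'
      refine ⟨e.symm i', H ?_, e.apply_symm_apply i'⟩
      rw [Set.mem_preimage, ← he, e.apply_symm_apply]
      exact hi'
    · intro H i hi
      obtain ⟨j, hj, hji⟩ := H (show e i ∈ _ by rw [Set.mem_preimage, he]; exact hi)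
      rwa [← e.injective hji]

end Circuit

/-! ### Cyclic polytopes with d + 2 vertices -/

section MomentCurve

variable {d : ℕ}

/-- The point with parameter `t` on the moment curve in `ℝ^d`. -/
noncomputable def momentPoint (d : ℕ) (t : ℝ) : EuclideanSpace ℝ (Fin d) :=
  WithLp.toLp 2 fun j : Fin d => t ^ ((j : ℕ) + 1)

theorem momentPolytope_eq {N : ℕ} (t : Fin N → ℝ) :
    momentPolytope d t = convexHull ℝ (Set.range fun i => momentPoint d (t i)) := rfl

/-- The coordinates give the powers 1 to `d`, and the vanishing sum of coefficients gives the power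
0. -/
theorem IsDep.sum_mul_eval {ι : Type*} [Fintype ι] {t : ι → ℝ} {a : ι → ℝ}
    (ha : IsDep (fun i => momentPoint d (t i)) a) {q : Polynomial ℝ} (hq : q.natDegree ≤ d) :
    ∑ i, a i * q.eval (t i) = 0 := by
  have hpow : ∀ j ≤ d, ∑ i, a i * t i ^ j = 0 := by
    intro j hj
    rcases j with _ | j
    · simpa using ha.1
    · have := congrArg (fun z : EuclideanSpace ℝ (Fin d) => z ⟨j, hj⟩) ha.2
      simpa [momentPoint] using this
  simp only [Polynomial.eval_eq_sum_range' (Nat.lt_succ_of_le hq), Finset.mul_sum]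
  rw [Finset.sum_comm]
  refine Finset.sum_eq_zero fun j hj => ?_
  have := hpow j (Nat.lt_succ_iff.1 (Finset.mem_range.1 hj))
  rw [← mul_zero (q.coeff j), ← this, Finset.mul_sum]
  exact Finset.sum_congr rfl fun i _ => by ring

/-- In an affine dependence of `d + 2` points on the moment curve in `ℝ^d`, each coefficient is
a fixed negative multiple of the preceding one. -/
theorem exists_ratio_momentPoint {t : Fin (d + 2) → ℝ} (ht : StrictMono t) (i : Fin (d + 1)) :
    ∃ ρ : ℝ, 0 < ρ ∧ ∀ a, IsDep (fun i => momentPoint d (t i)) a →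
      a i.succ = -ρ * a i.castSucc := by
  classical
  set s : Finset (Fin (d + 2)) := {i.castSucc, i.succ}ᶜ with hs
  -- Tested against a polynomial vanishing at the other `d` parameters, only two terms of a
  -- dependence survive. `q` has the same sign at both, since no root lies between them.
  set q : Polynomial ℝ := ∏ j ∈ s, (Polynomial.X - Polynomial.C (t j)) with hq
  have hne : i.castSucc ≠ i.succ := i.castSucc_lt_succ.ne
  have hscard : s.card = d := by
    rw [hs, Finset.card_compl, Fintype.card_fin, Finset.card_pair hne]
    rfl
  have hdeg : q.natDegree ≤ d := by
    rw [hq, Polynomial.natDegree_prod_of_monic _ _ fun j _ => Polynomial.monic_X_sub_C _]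
    simp [hscard]
  have heval : ∀ k, q.eval (t k) = ∏ j ∈ s, (t k - t j) := fun k => by
    simp [hq, Polynomial.eval_prod]
  have hpos : 0 < q.eval (t i.castSucc) * q.eval (t i.succ) := by
    rw [heval, heval, ← Finset.prod_mul_distrib]
    refine Finset.prod_pos fun j hj => ?_
    have hj1 : j ≠ i.castSucc := fun h => by simp [hs, h] at hj
    have hj2 : j ≠ i.succ := fun h => by simp [hs, h] at hj
    rcases lt_or_gt_of_ne hj1 with h | h
    · exact mul_pos (sub_pos.2 (ht h)) (sub_pos.2 (ht (h.trans i.castSucc_lt_succ)))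
    · have h' : i.succ < j := lt_of_le_of_ne (Fin.castSucc_lt_iff_succ_le.1 h) hj2.symm
      exact mul_pos_of_neg_of_neg (sub_neg.2 (ht h)) (sub_neg.2 (ht h'))
  have h0 : q.eval (t i.succ) ≠ 0 := right_ne_zero_of_mul hpos.ne'
  refine ⟨q.eval (t i.castSucc) / q.eval (t i.succ), ?_, fun a ha => ?_⟩
  · rw [← mul_div_mul_right _ _ h0]
    exact div_pos hpos (mul_self_pos.2 h0)
  · have h1 := ha.sum_mul_eval hdeg
    rw [← Finset.sum_add_sum_compl s, Finset.sum_eq_zero, hs, compl_compl, Finset.sum_pair hne] at h1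
    · field_simp
      linarith
    · intro j hj
      rw [heval, Finset.prod_eq_zero hj (sub_self _), mul_zero]

/-- `d + 2` points on the moment curve in `ℝ^d` form a circuit with alternating signs. -/
theorem exists_isCircuit_momentPoint {t : Fin (d + 2) → ℝ} (ht : StrictMono t) :
    ∃ c, IsCircuit (fun i => momentPoint d (t i)) c ∧ ∀ i : Fin (d + 2), 0 < (-1) ^ (i : ℕ) * c i := by
  choose ρ hρ hρa using exists_ratio_momentPoint ht
  have hzero : ∀ a, IsDep (fun i => momentPoint d (t i)) a → a 0 = 0 → a = 0 := by
    intro a ha h0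
    ext i
    induction i using Fin.induction with
    | zero => exact h0
    | succ i ih => rw [hρa i a ha, ih]; simp
  -- There are `d + 2` unknowns and `d + 1` equations.
  obtain ⟨a, ha, hane⟩ := Submodule.exists_mem_ne_zero_of_ne_bot
    (LinearMap.ker_ne_bot_of_finrank_lt (f := depMap fun i => momentPoint d (t i)) (by simp))
  rw [mem_ker_depMap] at ha
  have ha0 : a 0 ≠ 0 := fun h => hane (hzero a ha h)
  have hsmul : ∀ (r : ℝ) (b : Fin (d + 2) → ℝ), IsDep (fun i => momentPoint d (t i)) b →
      IsDep (fun i => momentPoint d (t i)) (r • b) := fun r b hb => by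
    rw [← mem_ker_depMap] at hb ⊢
    exact Submodule.smul_mem _ r hb
  have hc := hsmul (a 0)⁻¹ a ha
  set c := (a 0)⁻¹ • a with hcdef
  have hc0 : c 0 = 1 := by simp [hcdef, ha0]
  refine ⟨c, ⟨fun h => one_ne_zero (hc0.symm.trans (congrFun h 0)), fun b => ⟨fun hb => ?_, ?_⟩⟩,
    fun i => ?_⟩
  · refine ⟨b 0, sub_eq_zero.1 (hzero _ ?_ (by simp [hc0]))⟩
    have h1 := hsmul (b 0) c hc
    rw [← mem_ker_depMap] at hb h1 ⊢
    exact Submodule.sub_mem _ hb h1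
  · rintro ⟨r, rfl⟩
    exact hsmul r c hc
  · induction i using Fin.induction with
    | zero => simp [hc0]
    | succ i ih =>
      rw [hρa i c hc, Fin.val_succ, pow_succ]
      have := mul_pos (hρ i) ih
      rw [Fin.val_castSucc] at this
      linarith

theorem card_alternating {k : ℕ} {c : Fin (2 * k) → ℝ}
    (hc : ∀ i : Fin (2 * k), 0 < (-1) ^ (i : ℕ) * c i) (b : Bool) :
    Nat.card {i // decide (0 < c i) = b} = k := by
  have hpar : ∀ i : Fin (2 * k), decide (0 < c i) = b ↔ (i : ℕ) % 2 = if b then 0 else 1 := by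
    intro i
    have hi := hc i
    rcases Nat.even_or_odd (i : ℕ) with he | ho
    · rw [he.neg_one_pow, one_mul] at hi
      rw [Nat.even_iff.1 he, decide_eq_true hi]
      cases b <;> simp
    · rw [ho.neg_one_pow] at hi
      rw [Nat.odd_iff.1 ho, decide_eq_false (by linarith)]
      cases b <;> simp
  have e : Fin k ≃ {i // decide (0 < c i) = b} :=
    { toFun := fun j => ⟨⟨2 * j + if b then 0 else 1, by have := j.2; split_ifs <;> omega⟩, by
        rw [hpar]; cases b <;> simp⟩
      invFun := fun i => ⟨(i.1 : ℕ) / 2, by have := i.1.2; omega⟩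
      left_inv := fun j => by ext; cases b <;> simp; omega
      right_inv := fun i => by
        have := (hpar i.1).1 i.2
        ext
        cases b <;> simp at this ⊢ <;> omega }
  rw [← Nat.card_congr e, Nat.card_fin]

/-- The hull of a circuit with full support and `k` points on either side is a cyclic polytope. -/
theorem IsCircuit.isCyclicPolytope {ι W : Type*} [Fintype ι] [AddCommGroup W] [Module ℝ W]
    [TopologicalSpace W] [IsTopologicalAddGroup W] [ContinuousSMul ℝ W] [T2Space W]
    [FiniteDimensional ℝ W] {x : ι → W} {c : ι → ℝ} (h : IsCircuit x c) (hc : ∀ i, c i ≠ 0)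
    {k : ℕ} (hk : 1 ≤ k) (hcard : ∀ b, Nat.card {i // decide (0 < c i) = b} = k) :
    IsCyclicPolytope (2 * k) (2 * k - 2) (convexHull ℝ (Set.range x)) := by
  -- With `k + 1` for `k`, the number of points is definitionally the dimension plus two.
  obtain ⟨k, rfl⟩ := Nat.exists_eq_add_of_le' hk
  constructor
  · have hι : Nat.card ι = 2 * (k + 1) := by
      rw [← Nat.card_congr (Equiv.sigmaFiberEquiv fun i => decide (0 < c i)), Nat.card_sigma]
      rw [Fintype.sum_bool, hcard, hcard, two_mul]
    rw [← Set.image_univ]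
    refine h.isPolytope (J := Set.univ) (fun _ _ => Set.mem_univ _) ?_
    rw [Set.ncard_univ, hι]
    omega
  · intro t ht
    obtain ⟨c', h', hc'⟩ := exists_isCircuit_momentPoint (d := 2 * (k + 1) - 2) ht
    rw [momentPolytope_eq]
    refine h.combEquiv hc h' (fun i hi => ?_) fun b => ?_
    · have := hc' i
      rw [hi, mul_zero] at this
      exact lt_irrefl _ this
    · rw [hcard]
      exact (card_alternating (k := k + 1) hc' b).symm

end MomentCurve

/-! ### Free sums of three simplices with equally many vertices -/

section ThreeSimplices

variable {ι W : Type*} [Fintype ι] [AddCommGroup W] [Module ℝ W] {x : ι → W} {c : ι → Fin 3}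
  {k : ℕ}

theorem card_eq_three_mul (hk : ∀ i, {f | c f = i}.ncard = k) : Nat.card ι = 3 * k := by
  rw [← Nat.card_congr (Equiv.sigmaFiberEquiv c), Nat.card_sigma]
  rw [Finset.sum_congr rfl fun i _ => show Nat.card {f // c f = i} = k from hk i]
  simp

/-- Here equal class sizes matter: constants of sum 0 on the classes give coefficients of sum 0, so
linear dependences are affine. -/
theorem sum_comp_color (hk : ∀ i, {f | c f = i}.ncard = k) (α : Fin 3 → ℝ) :
    ∑ f, α (c f) = k * ∑ i, α i := by
  classical
  rw [← Finset.sum_fiberwise Finset.univ c, Finset.mul_sum]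
  refine Finset.sum_congr rfl fun i _ => ?_
  rw [Finset.sum_congr rfl fun f hf => by rw [(Finset.mem_filter.1 hf).2], Finset.sum_const,
    nsmul_eq_mul, ← hk i, Set.ncard_eq_toFinset_card']
  simp

theorem not_preimage_subset (hk : ∀ i, {f | c f = i}.ncard = k) {J : Set ι} (hJ : J.ncard < k)
    (i : Fin 3) : ¬ c ⁻¹' {i} ⊆ J := fun h => by
  have := Set.ncard_le_ncard h (Set.toFinite J)
  rw [show c ⁻¹' {i} = {f | c f = i} from rfl, hk] at this
  omega

namespace IsFreeSum

theorem isFacial_of_ncard_lt (h : IsFreeSum x c fun _ => 1) 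
    (hk : ∀ i, {f | c f = i}.ncard = k) {J : Set ι} (hJ : J.ncard < k) : IsFacial x J :=
  (h.isFacial_iff J).2 (Or.inr (not_preimage_subset hk hJ))

theorem isFacial_singleton (h : IsFreeSum x c fun _ => 1) (hk : ∀ i, {f | c f = i}.ncard = k)
    (hk2 : 2 ≤ k) (f : ι) : IsFacial x {f} :=
  h.isFacial_of_ncard_lt hk (by rw [Set.ncard_singleton]; omega)

theorem injective (h : IsFreeSum x c fun _ => 1) (hk : ∀ i, {f | c f = i}.ncard = k)
    (hk2 : 2 ≤ k) : Function.Injective x := fun f g hfg => by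
  have := (h.isFacial_singleton hk hk2 g).mem_iff f
  rw [Set.image_singleton, convexHull_singleton] at this
  exact this.1 hfg

end IsFreeSum

section Topology

theorem IsFreeSum.isSimplicial [TopologicalSpace W] (h : IsFreeSum x c fun _ => 1) :
    IsSimplicial (convexHull ℝ (Set.range x)) := by
  rintro F ⟨hF, hne⟩
  have hJ := eq_convexHull_of_isExposed hF
  rw [hJ.2]
  rcases (h.isFacial_iff _).1 hJ.1 with huniv | hJ'
  · refine (hne (hJ.2.trans ?_)).elim
    rw [huniv, Set.image_univ]
  · exact isSimplex_of_affineIndependent (h.affineIndependent hJ')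

variable [TopologicalSpace W] [IsTopologicalAddGroup W] [ContinuousSMul ℝ W] [T2Space W]
  [FiniteDimensional ℝ W]

theorem vertices_eq_range_of_isFacial (hx : ∀ f, IsFacial x {f}) :
    vertices (convexHull ℝ (Set.range x)) = Set.range x := by
  refine extremePoints_convexHull_subset.antisymm ?_
  rintro _ ⟨f, rfl⟩
  have := (hx f).isExposed.isExtreme
  rwa [Set.image_singleton, convexHull_singleton, isExtreme_singleton] at this

theorem vertices_convexHull_image (hx : ∀ f, IsFacial x {f}) (J : Set ι) :
    vertices (convexHull ℝ (x '' J)) = x '' J := by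
  refine extremePoints_convexHull_subset.antisymm fun y hy => ?_
  refine inter_extremePoints_subset_extremePoints_of_subset
    (convexHull_mono (Set.image_subset_range x J)) ⟨subset_convexHull ℝ _ hy, ?_⟩
  exact (vertices_eq_range_of_isFacial hx).ge (Set.image_subset_range x J hy)

/-- A priori `J` need not be facial; the first direction passes to the larger set of all indices
whose points lie on the face. -/
theorem IsFreeSum.isProperFace_iff (h : IsFreeSum x c fun _ => 1) 
    (hsurj : Function.Surjective c) (J : Set ι) :
    IsProperFace (convexHull ℝ (Set.range x)) (convexHull ℝ (x '' J)) ↔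
      ∀ i, ¬ c ⁻¹' {i} ⊆ J := by
  constructor
  · rintro ⟨hF, hne⟩ i hi
    have hJ := eq_convexHull_of_isExposed hF
    rcases (h.isFacial_iff _).1 hJ.1 with huniv | hJ'
    · refine hne (hJ.2.trans ?_)
      rw [huniv, Set.image_univ]
    · exact hJ' i fun f hf => subset_convexHull ℝ _ ⟨f, hi hf, rfl⟩
  · intro hJ
    have hJf := (h.isFacial_iff J).2 (Or.inr hJ)
    refine ⟨hJf.isExposed, fun heq => ?_⟩
    obtain ⟨f, -⟩ := hsurj 0
    exact hJ 0 fun f _ => (hJf.mem_iff f).1 (heq ▸ subset_convexHull ℝ _ ⟨f, rfl⟩)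

theorem IsFreeSum.isNeighborly (h : IsFreeSum x c fun _ => 1) 
    (hk : ∀ i, {f | c f = i}.ncard = k) (hk2 : 2 ≤ k) :
    IsNeighborly (k - 1) (convexHull ℝ (Set.range x)) := by
  intro s hs hcard
  have hx := h.isFacial_singleton hk hk2
  rw [vertices_eq_range_of_isFacial hx] at hs
  obtain ⟨J, hJ⟩ := Set.subset_range_iff_exists_image_eq.1 hs
  have hJk : J.ncard < k := by
    rw [← Set.ncard_image_of_injective J (h.injective hk hk2), hJ, Set.ncard_coe_finset]
    omega
  refine ⟨convexHull ℝ (x '' J), (h.isProperFace_iff (fun i => ?_) J).2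
    (not_preimage_subset hk hJk), by rw [vertices_convexHull_image hx, hJ]⟩
  have : {f | c f = i}.Nonempty := Set.nonempty_of_ncard_ne_zero (by rw [hk]; omega)
  exact this

/-- The decomposition of a free sum of three simplices with equally many vertices: removing a
vertex leaves a multiple pyramid over a cyclic polytope. -/
theorem IsFreeSum.exists_decomposition (h : IsFreeSum x c fun _ => 1) 
    (hk : ∀ i, {f | c f = i}.ncard = k) (hk2 : 2 ≤ k) :
    ∃ (w : W) (Q K : Set W),
      convexHull ℝ (Set.range x) = convexHull ℝ (insert w Q) ∧
      IsPolytope (3 * k - 3) Q ∧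
      IsCyclicPolytope (2 * k) (2 * k - 2) K ∧
      IsFoldPyramid (k - 1) (3 * k - 3) Q K ∧
      (∀ F ∈ facets Q, IsBeyond w Q F ↔ ¬ IsSimplex F) ∧
      {F ∈ facets Q | ¬ IsSimplex F}.ncard = k - 1 := by
  classical
  obtain ⟨f₀, hf₀⟩ : {f | c f = 0}.Nonempty := Set.nonempty_of_ncard_ne_zero (by rw [hk]; omega)
  rw [Set.mem_ofPred_eq] at hf₀
  have hsub : ∀ (p : ι → Prop), ({f : {f // f ≠ f₀} | p f} : Set {f // f ≠ f₀}).ncard =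
      ({f | p f} \ {f₀} : Set ι).ncard := fun p => by
    rw [← Set.ncard_image_of_injective _ Subtype.val_injective]
    congr 1
    ext f
    simp [and_comm]
  have hclass : ∀ i, i ≠ 0 → ({f : {f // f ≠ f₀} | c f = i} : Set _).ncard = k := fun i hi => by
    rw [hsub fun f => c f = i, Set.sdiff_singleton_eq_self, hk]
    exact fun hf => hi (hf.symm.trans hf₀)
  have hclass0 : ({f : {f // f ≠ f₀} | c f = 0} : Set _).ncard = k - 1 := by
    rw [hsub fun f => c f = 0, Set.ncard_sdiff_singleton_of_mem (by exact hf₀), hk]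
  let xQ : {f // f ≠ f₀} → W := fun f => x f
  -- Dependences of the remaining points are those with coefficient 0 at `f₀`, that is, with
  -- constant 0 on color 0, and so `r`, `-r` on colors 1 and 2.
  let s : Fin 3 → ℝ := ![0, 1, -1]
  let cQ : {f // f ≠ f₀} → ℝ := fun f => s (c f)
  have hs0 : ∀ i, s i = 0 ↔ i = 0 := by intro i; fin_cases i <;> simp [s]
  have hcQ0 : ∀ f, cQ f = 0 ↔ c f = 0 := fun f => hs0 _
  have hne : ∀ i, i ≠ 0 → ∃ f : {f // f ≠ f₀}, c f = i := fun i hi => by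
    have : ({f : {f // f ≠ f₀} | c f = i} : Set _).Nonempty :=
      Set.nonempty_of_ncard_ne_zero (by rw [hclass i hi]; omega)
    exact this
  have hcirc : IsCircuit xQ cQ := by
    refine ⟨fun h0 => ?_, fun a => ?_⟩
    · obtain ⟨f, hf⟩ := hne 1 one_ne_zero
      have := (hcQ0 f).1 (congrFun h0 f)
      rw [hf] at this
      exact one_ne_zero this
    · rw [isDep_subtype_iff x, h.isDep_iff]
      constructor
      · rintro ⟨α, hα, ha⟩
        have h0 : α 0 = 0 := by simpa [hf₀] using (ha f₀).symm
        refine ⟨α 1, funext fun f => ?_⟩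
        have haf := ha f
        rw [dif_pos f.2, mul_one] at haf
        rw [Fin.sum_univ_three, h0] at hα
        rw [haf, Pi.smul_apply, smul_eq_mul]
        change _ = α 1 * s (c f)
        generalize c f = i
        fin_cases i
        · simp [s, h0]
        · simp [s]
        · simp [s]
          linarith
      · rintro ⟨r, rfl⟩
        refine ⟨fun i => r * s i, ?_, fun f => ?_⟩
        · simp [Fin.sum_univ_three, s]
        · by_cases hf : f = f₀
          · simp [hf, hf₀, s]
          · simp [hf, cQ]
  have hxQ : Function.Injective xQ := (h.injective hk hk2).comp Subtype.val_injective
  have hrange : Set.range xQ ⊆ Set.range x := by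
    rintro _ ⟨f, rfl⟩
    exact ⟨f, rfl⟩
  have hext : ∀ f, xQ f ∈ vertices (convexHull ℝ (Set.range xQ)) := fun f => by
    refine inter_extremePoints_subset_extremePoints_of_subset (convexHull_mono hrange)
      ⟨subset_convexHull ℝ _ ⟨f, rfl⟩, ?_⟩
    rw [show (convexHull ℝ (Set.range x)).extremePoints ℝ = Set.range x from
      vertices_eq_range_of_isFacial (h.isFacial_singleton hk hk2)]
    exact ⟨f, rfl⟩
  -- the removed vertex in terms of the others
  let u : Fin 3 → ℝ := ![-1, 1, 0]
  have hu : IsDep x fun f => u (c f) :=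
    (h.isDep_iff _).2 ⟨u, by simp [Fin.sum_univ_three, u], fun f => (mul_one _).symm⟩
  have hu0 : u (c f₀) = -1 := by rw [hf₀]; rfl
  have hμ1 : ∑ f : {f // f ≠ f₀}, u (c f) = 1 := by
    have := hu.1
    rw [Fintype.sum_eq_add_sum_subtype_ne _ f₀, hu0] at this
    linarith
  have hw : ∑ f : {f // f ≠ f₀}, u (c f) • xQ f = x f₀ := by
    have := hu.2
    beta_reduce at this
    rw [Fintype.sum_eq_add_sum_subtype_ne _ f₀, hu0, neg_one_smul, neg_add_eq_zero] at this
    exact this.symm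
  have hsupp : ({f | cQ f ≠ 0} : Set _).ncard = (2 * k - 2) + 2 := by
    have : ({f | cQ f ≠ 0} : Set _) = {f : {f // f ≠ f₀} | c f = 1} ∪ {f | c f = 2} := by
      ext f
      simp only [Set.mem_ofPred_eq, Set.mem_union, ne_eq, hcQ0]
      generalize c f = i
      revert i
      decide
    rw [this, Set.ncard_union_eq, hclass 1 one_ne_zero, hclass 2 (by decide)]
    · omega
    · rw [Set.disjoint_left]
      intro f hf hf'
      rw [Set.mem_ofPred_eq] at hf hf'
      rw [hf] at hf'
      exact absurd hf' (by decide)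
  have hzero : ({f | cQ f = 0} : Set _).ncard = k - 1 := by
    simp only [hcQ0]
    exact hclass0
  refine ⟨x f₀, convexHull ℝ (Set.range xQ), convexHull ℝ (xQ '' {f | cQ f ≠ 0}), ?_, ?_, ?_, ?_,
    fun F hF => ?_, ?_⟩
  · rw [Set.insert_eq, convexHull_convexHull_union_right, ← Set.insert_eq]
    congr 1
    ext y
    constructor
    · rintro ⟨f, rfl⟩
      by_cases hf : f = f₀
      · exact Or.inl (by rw [hf])
      · exact Or.inr ⟨⟨f, hf⟩, rfl⟩
    · rintro (rfl | hy)
      exacts [⟨f₀, rfl⟩, hrange hy]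
  -- There are 3k - 1 points with one dependence, so the dimension is 3k - 3.
  · rw [← Set.image_univ]
    refine hcirc.isPolytope (J := Set.univ) (fun _ _ => Set.mem_univ _) ?_
    have h1 := Set.ncard_add_ncard_compl ({f | cQ f = 0} : Set {f // f ≠ f₀})
    rw [show ({f | cQ f = 0} : Set {f // f ≠ f₀})ᶜ = {f | cQ f ≠ 0} from rfl, hsupp, hzero] at h1
    rw [Set.ncard_univ, ← h1]
    omega
  · rw [Set.image_eq_range]
    refine hcirc.subtype_support.isCyclicPolytope (fun f => f.2) (by omega) fun b => ?_
    have hb : ∀ f, (cQ f ≠ 0 ∧ decide (0 < cQ f) = b) ↔ c f = if b then 1 else 2 := by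
      intro f
      change s (c f) ≠ 0 ∧ decide (0 < s (c f)) = b ↔ _
      generalize c f = i
      fin_cases i <;> cases b <;> simp [s]
    rw [← hclass (if b then 1 else 2) (by cases b <;> simp), ← Nat.card_coe_set_eq]
    exact Nat.card_congr
      ((Equiv.subtypeSubtypeEquivSubtypeInter (fun f => cQ f ≠ 0)
        (fun f => decide (0 < cQ f) = b)).trans (Equiv.subtypeEquivRight hb))
  · have hT : ((Finset.univ.filter fun f => cQ f = 0 : Finset {f // f ≠ f₀}) : Set _) =
        {f | cQ f = 0} := by simp
    have := hcirc.isFoldPyramid (Finset.univ.filter fun f => cQ f = 0) (by simp) hsupp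
    rw [← Set.ncard_coe_finset, hT, hzero] at this
    rw [show ({f | cQ f ≠ 0} ∪ {f | cQ f = 0} : Set {f // f ≠ f₀}) = Set.univ from
      Set.compl_union_self _, Set.image_univ] at this
    convert this using 1
    omega
  -- In `hw` the coefficients are -1 at the apices (color 0), 1 at color 1 and 0 at color 2, as
  -- `IsCircuit.isBeyond_iff` requires.
  · rw [← hw]
    refine hcirc.isBeyond_iff hxQ hext hμ1 (fun f hf => ?_) (fun f hf => ?_) hF
    · rw [(hcQ0 f).1 hf]
      simp [u]
    · have := mt (hcQ0 f).2 hf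
      revert this
      generalize c f = i
      fin_cases i <;> simp [u]
  · rw [hcirc.ncard_nonsimplex_facets hxQ hext, hzero]

end Topology

/-! ### The Gale diagram -/

section Gale

/-- The Gale transform of a free sum of three simplices, before normalization. -/
noncomputable def galeVector : Fin 3 → EuclideanSpace ℝ (Fin 2) :=
  ![!₂[1, 1], !₂[-1, 0], !₂[0, -1]]

theorem galePoint_eq (i : Fin 3) : galePoint i = ‖galeVector i‖⁻¹ • galeVector i := by
  fin_cases i
  · have : ‖galeVector 0‖ = √2 := by
      simp [galeVector, EuclideanSpace.norm_eq, Fin.sum_univ_two]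
      norm_num
    change galePoint 0 = ‖galeVector 0‖⁻¹ • galeVector 0
    rw [this]
    ext j
    fin_cases j <;> simp [galePoint, galeVector]
  · have : ‖galeVector 1‖ = 1 := by
      simp [galeVector, EuclideanSpace.norm_eq, Fin.sum_univ_two]
    change galePoint 1 = ‖galeVector 1‖⁻¹ • galeVector 1
    rw [this, inv_one, one_smul]
    rfl
  · have : ‖galeVector 2‖ = 1 := by
      simp [galeVector, EuclideanSpace.norm_eq, Fin.sum_univ_two]
    change galePoint 2 = ‖galeVector 2‖⁻¹ • galeVector 2
    rw [this, inv_one, one_smul]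
    rfl

theorem galePoint_injective : Function.Injective galePoint := by
  have h2 : 0 < √(2 : ℝ) := by positivity
  have key : ∀ i j, galePoint i 0 = galePoint j 0 → galePoint i 1 = galePoint j 1 → i = j := by
    intro i j
    fin_cases i <;> fin_cases j <;> simp [galePoint]
    all_goals
      intro _ _
      linarith
  exact fun i j hij => key i j (by rw [hij]) (by rw [hij])

theorem finsum_range {ι W M : Type*} [Fintype ι] [AddCommMonoid M] {x : ι → W}
    (hx : Function.Injective x) (g : Set.range x → M) : ∑ᶠ y, g y = ∑ f, g ⟨x f, f, rfl⟩ := by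
  rw [← finsum_comp_equiv (Equiv.ofInjective x hx), finsum_eq_sum_of_fintype]
  rfl

theorem isAffineDependence_range_iff (hx : Function.Injective x) (a : Set.range x → ℝ) :
    IsAffineDependence (Set.range x) a ↔ IsDep x fun f => a ⟨x f, f, rfl⟩ := by
  rw [IsAffineDependence, IsDep, finsum_range hx, finsum_range hx]

theorem IsFreeSum.exists_galeDiagram (h : IsFreeSum x c fun _ => 1)
    (hk : ∀ i, {f | c f = i}.ncard = k) (hk2 : 2 ≤ k) :
    ∃ g : Set.range x → EuclideanSpace ℝ (Fin 2), IsGaleDiagram (Set.range x) g ∧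
      ∀ f, g ⟨x f, f, rfl⟩ = galePoint (c f) := by
  have hx := h.injective hk hk2
  have hne : ∀ i, ∃ f, c f = i := fun i => by
    have : {f | c f = i}.Nonempty := Set.nonempty_of_ncard_ne_zero (by rw [hk]; omega)
    exact this
  let e := Equiv.ofInjective x hx
  have he : ∀ f, e.symm ⟨x f, f, rfl⟩ = f := fun f => e.symm_apply_apply f
  let z : Set.range x → EuclideanSpace ℝ (Fin 2) := fun y => galeVector (c (e.symm y))
  have hz : ∀ f, z ⟨x f, f, rfl⟩ = galeVector (c f) := fun f => by simp only [z, he]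
  refine ⟨fun y => galePoint (c (e.symm y)), ⟨z, ⟨Set.finite_range x, ?_, fun a => ?_⟩,
    fun y => galePoint_eq _⟩, fun f => by simp only [he]⟩
  · rw [Fintype.linearIndependent_iff]
    intro r hr
    obtain ⟨f₁, hf₁⟩ := hne 1
    obtain ⟨f₂, hf₂⟩ := hne 2
    have h1 := congrFun hr ⟨x f₁, f₁, rfl⟩
    have h2 := congrFun hr ⟨x f₂, f₂, rfl⟩
    simp [Fin.sum_univ_two, hz, hf₁, hf₂, galeVector] at h1 h2
    intro j
    fin_cases j
    exacts [h1, h2]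
  · rw [isAffineDependence_range_iff hx, h.isDep_iff, Submodule.mem_span_range_iff_exists_fun]
    constructor
    · rintro ⟨α, hα, ha⟩
      -- In these coordinates colors 1 and 2 sit at the negative unit vectors, and color 0 at (1, 1)
      -- because α 0 = -α 1 - α 2.
      refine ⟨![-α 1, -α 2], funext ?_⟩
      rintro ⟨_, f, rfl⟩
      rw [Fin.sum_univ_three] at hα
      have haf := ha f
      rw [mul_one] at haf
      rw [haf]
      simp only [Fin.sum_univ_two, Pi.add_apply, Pi.smul_apply, hz, smul_eq_mul]
      generalize c f = i
      fin_cases i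
      · simp [galeVector]
        linarith
      · simp [galeVector]
      · simp [galeVector]
    · rintro ⟨r, rfl⟩
      refine ⟨fun i => r 0 * galeVector i 0 + r 1 * galeVector i 1, ?_, fun f => ?_⟩
      · simp [Fin.sum_univ_three, galeVector]
      · simp [Fin.sum_univ_two, hz]

end Gale

end ThreeSimplices

end PolytopeColoring

/-! ### The theorem -/

theorem proposition4 {E : Type*} [NormedAddCommGroup E] [NormedSpace ℝ E] [FiniteDimensional ℝ E]
    (P : Set E) (hP : IsPolytope 3 P) (hsimple : IsSimple3 P)
    (c : facets P → Fin 3) (hc : IsProperColoring P c)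
    (n : ℕ) (hn : (vertices P).ncard = 2 * n)
    (m : Fin 3 → ℕ) (hm : ∀ i, {f : facets P | c f = i}.ncard = m i)
    (h32 : m 2 = m 1) (h21 : m 1 = m 0) (hm2 : 2 ≤ m 0) :
    -- the vertices are the incidence vectors
    vertices (incidencePolytope P) = incidenceVectors P ∧
    -- the Gale diagram, with its multiplicities
    (∃ g : vertices (incidencePolytope P) → EuclideanSpace ℝ (Fin 2),
      IsGaleDiagram (vertices (incidencePolytope P)) g ∧
      ∀ i, (∀ x, g x = galePoint i ↔ (x : vertices P → ℝ) ∈ colorClass P c i) ∧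
        {x | g x = galePoint i}.ncard = m i) ∧
    -- the proper faces
    (∀ J ⊆ incidenceVectors P,
      IsProperFace (incidencePolytope P) (convexHull ℝ J) ↔ ∀ i, ¬ colorClass P c i ⊆ J) ∧
    IsSimplicial (incidencePolytope P) ∧
    IsNeighborly (m 1 - 1) (incidencePolytope P) ∧
    -- the decomposition
    (∃ (w : vertices P → ℝ) (Q K : Set (vertices P → ℝ)),
      incidencePolytope P = convexHull ℝ (insert w Q) ∧
      IsPolytope (n - 1) Q ∧
      IsCyclicPolytope (2 * m 1) (2 * m 1 - 2) K ∧
      IsFoldPyramid (m 1 - 1) (n - 1) Q K ∧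
      (∀ F ∈ facets Q, IsBeyond w Q F ↔ ¬ IsSimplex F) ∧
      {F ∈ facets Q | ¬ IsSimplex F}.ncard = m 1 - 1) := by
  have hk : ∀ i, {f : facets P | c f = i}.ncard = m 0 := fun i => by
    rw [hm]
    fin_cases i
    exacts [rfl, h21, h32.trans h21]
  -- `ncard` is 0 on infinite sets, so color classes of positive `ncard` are finite.
  have : Finite (facets P) := by
    rw [← Set.finite_univ_iff]
    refine (Set.finite_iUnion fun i => Set.finite_of_ncard_ne_zero
      (s := {f : facets P | c f = i}) (by rw [hk]; omega)).subset fun f _ => ?_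
    exact Set.mem_iUnion.2 ⟨c f, rfl⟩
  have : Finite (vertices P) := hP.finite_vertices.to_subtype
  have := Fintype.ofFinite (facets P)
  have := Fintype.ofFinite (vertices P)
  let Φ : ∀ v : vertices P, VertexFrame P c v := fun v =>
    (nonempty_vertexFrame hP hsimple hc v.2).some
  let x : facets P → vertices P → ℝ := fun f => incidenceVector P f
  have h : IsFreeSum x c fun _ => 1 := by
    refine ⟨fun _ => one_pos, fun a => ?_⟩
    have hlin := sum_smul_incidenceVector_eq_zero_iff hP Φ a
    simp only [mul_one]
    refine ⟨fun ha => hlin.1 ha.2, fun ha => ⟨?_, hlin.2 ha⟩⟩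
    obtain ⟨α, hα, haα⟩ := ha
    rw [Finset.sum_congr rfl fun f _ => haα f, sum_comp_color hk, hα, mul_zero]
  -- Euler's formula with 3m facets and 2n vertices reads 6m = 2n + 4.
  have hn3 : n - 1 = 3 * m 0 - 3 := by
    have h1 := two_mul_card_facets hP Φ
    have h2 := card_eq_three_mul hk
    rw [← Nat.card_eq_fintype_card, ← Nat.card_eq_fintype_card, h2, Nat.card_coe_set_eq, hn] at h1
    omega
  have hx := h.injective hk hm2
  have hvert : vertices (incidencePolytope P) = incidenceVectors P :=
    vertices_eq_range_of_isFacial (h.isFacial_singleton hk hm2)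
  have hcolor : ∀ i, colorClass P c i = x '' (c ⁻¹' {i}) := fun i => rfl
  refine ⟨hvert, ?_, fun J hJ => ?_, h.isSimplicial, ?_, ?_⟩
  · rw [hvert]
    obtain ⟨g, hg, hgx⟩ := h.exists_galeDiagram hk hm2
    have hiff : ∀ i f, g ⟨x f, f, rfl⟩ = galePoint i ↔ c f = i := fun i f => by
      rw [hgx, galePoint_injective.eq_iff]
    refine ⟨g, hg, fun i => ⟨?_, ?_⟩⟩
    · rintro ⟨_, f, rfl⟩
      rw [hcolor]
      exact (hiff i f).trans (hx.mem_set_image (s := c ⁻¹' {i})).symm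
    · rw [← hm i, ← Set.ncard_image_of_injective _ (Equiv.ofInjective x hx).injective]
      congr 1
      ext y
      constructor
      · obtain ⟨_, f, rfl⟩ := y
        exact fun hy => ⟨f, (hiff i f).1 hy, rfl⟩
      · rintro ⟨f, hf, rfl⟩
        exact (hiff i f).2 hf
  · obtain ⟨J, rfl⟩ := Set.subset_range_iff_exists_image_eq.1 hJ
    refine (h.isProperFace_iff (fun i => ?_) J).trans (forall_congr' fun i => ?_)
    · have : {f | c f = i}.Nonempty := Set.nonempty_of_ncard_ne_zero (by rw [hk]; omega)
      exact this
    · rw [hcolor]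
      exact not_congr (Set.image_subset_image_iff hx).symm
  · rw [h21]
    exact h.isNeighborly hk hm2
  · rw [h21, hn3]
    exact h.exists_decomposition hk hm2
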